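/- Let $F$ be a field of characteristic $p>0$, $K\supseteq F$ an algebraically closed field, and $A\subseteq M_n(K)$ a unital $F$-subalgebra. A *block degree* of $A$ is an integer $d\ge 1$ such that the $K$-algebra spanned by $A$ has $M_d(K)$ as a quotient. Polynomials are elements of the free associative unital algebra over $F$ on countably many indeterminates. A polynomial $f$ is *quasi-linear in $x_i$ on $A$* if all its evaluations on $A$ are additive in $x_i$. A *hike* of $f$ at $x_i$ replaces $x_i$ in $f$ by a polynomial that is linear in $x_i$. For $N\ge1$ let $c_N(y;w)=\sum_{\sigma\in S_N}\operatorname{sgn}(\sigma)\,y_{\sigma(1)}w_1y_{\sigma(2)}w_2\cdots y_{\sigma(N)}w_N$ be the Capelli polynomial. For a polynomial, or a function of substitutions, $\Phi$ that involves indeterminates $y_1,\dots,y_N$, and an element $a$, let the *polynomially defined characteristic coefficient* be the operator $$(\alpha_{k}(a)\Phi)(y_1,\dots,y_N,\dots)=\sum_{k_j\in\{0,1\},\ k_1+\dots+k_N=k}\Phi(a^{k_1}y_1,\dots,a^{k_N}y_N,\dots),$$ and put $\alpha_{\mathrm{pol},k}^{\bar q}(a)=\alpha_k(a^{\bar q})$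 for a $p$-power $\bar q$. A *commutator hike of matrix degree $d$* at $x_i$ replaces $x_i$ by $z\,C\,x_i$, where $z$ and all indeterminates in $C$ are distinct and new, and $C$ is one of the following commutators of expressions bonded by the Capelli polynomial $c_{d^2}$: 1. $C=\alpha_k(a)\alpha_{l}(b)E-\alpha_{l}(b)\alpha_k(a)E$, where $a,b$ are indeterminates and $E$ is $c_{d^2}(y;w)$, or is obtained from it by finitely many operators $\alpha_{k_j}(a_j)$ with indeterminates $a_j$; 2. $C=[E,E']$ with $E=c_{d^2}(y;w)\,v\,c_{d^2}(y;w')$ and $E'=(\alpha_k(a)c_{d^2})(y;w)\,v\,(\alpha_k(a)c_{d^2})(y;w')$, where $a,v$ are indeterminates. **Proposition.** Suppose that $f$ is not an identity of $A$ and is quasi-linear in $x_i$ on $A$. Then there are a polynomial $g$ obtained from $f$ by finitely many (possibly no) commutator hikes at $x_i$ whose matrix degrees are block degrees of $A$, a block degree $m$ of $A$, and new distinct indeterminates $z,y_1,\dots,y_{m^2},w_1,\dots,w_{m^2}$, such that the hiked polynomial $$h=g_{x_i\mapsto z\,c_{m^2}(y;w)\,x_i}$$ has the following properties. * $h$ is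 not an identity of $A$. * The polynomially defined characteristic coefficients with respect to $y_1,\dots,y_{m^2}$ commute with each other: for all $a,b\in A$, all $k,l$ and all $p$-powers $\bar q,\bar q'$, the operators $\alpha_{\mathrm{pol},k}^{\bar q}(a)$ and $\alpha_{\mathrm{pol},l}^{\bar q'}(b)$ commute on the smallest $F$-space of functions of substitutions in $A$ that contains the function given by $h$ and is stable under all such operators (for all elements of $A$ and all exponents). * Every further commutator hike of $h$ at $x_i$ of matrix degree $m$ is an identity of $A$. * On a diagonal block these operators are the characteristic coefficients: for $a\in M_m(K)$, $k\le m^2$ and a $p$-power $\bar q$, every evaluation on $M_m(K)$ satisfies $\alpha_{\mathrm{pol},k}^{\bar q}(a)\,c_{m^2}(y;w)=\alpha_k(T_a)^{\bar q}\,c_{m^2}(y;w)$, where $\alpha_k(T_a)$ is the $k$-th elementary symmetric function of the $m^2$ eigenvalues of left multiplication by $a$ on $M_m(K)$. -/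

import Mathlib

noncomputable section

namespace Hiking

/-- Noncommutative polynomials over `F` in the indeterminates `x_0, x_1, x_2, …`. -/
abbrev NCPoly (F : Type*) [Field F] : Type _ := FreeAlgebra F ℕ

/-- The indeterminate `x_j`. -/
abbrev X (F : Type*) [Field F] (j : ℕ) : NCPoly F := FreeAlgebra.ι F j

/-- The value of the polynomial `f` under the substitution `x_j ↦ v j` in an `F`-algebra. -/
def eval {F A : Type*} [Field F] [Ring A] [Algebra F A] (v : ℕ → A) (f : NCPoly F) : A :=
  FreeAlgebra.lift F v f

/-- `f` is a polynomial identity of `A`. -/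
def IsIdentity {F : Type*} [Field F] (A : Type*) [Ring A] [Algebra F A] (f : NCPoly F) : Prop :=
  ∀ v : ℕ → A, eval v f = 0

/-- `f` is `i`-quasi-linear on `A`. -/
def QuasiLinearAt {F : Type*} [Field F] (A : Type*) [Ring A] [Algebra F A] (i : ℕ)
    (f : NCPoly F) : Prop :=
  ∀ (v : ℕ → A) (a a' : A), eval (Function.update v i (a + a')) f =
    eval (Function.update v i a) f + eval (Function.update v i a') f

/-- The polynomial obtained from `f` by replacing `x_i` by `g`. -/
def subst {F : Type*} [Field F] (i : ℕ) (g f : NCPoly F) : NCPoly F :=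
  FreeAlgebra.lift F (Function.update (X F) i g) f

/-- The indeterminate `x_j` does not occur in `f`. -/
def Avoids {F : Type*} [Field F] (j : ℕ) (f : NCPoly F) : Prop :=
  f ∈ Algebra.adjoin F (X F '' {j}ᶜ)

/-- `g` is linear in `x_i`: it is a combination of products `u x_i v`, where `x_i` does not occur
in `u` and `v`. -/
def LinearIn {F : Type*} [Field F] (i : ℕ) (g : NCPoly F) : Prop :=
  g ∈ Submodule.span F {h | ∃ u v : NCPoly F, Avoids i u ∧ Avoids i v ∧ h = u * X F i * v}

/-- `f'` is obtained from `f` by one hike at `x_i`: some `g` linear in `x_i` is substituted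
for `x_i`. -/
def IsHike {F : Type*} [Field F] (i : ℕ) (f f' : NCPoly F) : Prop :=
  ∃ g : NCPoly F, LinearIn i g ∧ f' = subst i g f

/-- The indeterminates listed in `l` are distinct, differ from `x_i`, and do not occur in `f`. -/
def Fresh {F : Type*} [Field F] (i : ℕ) (f : NCPoly F) (l : List ℕ) : Prop :=
  l.Nodup ∧ ∀ j ∈ l, j ≠ i ∧ Avoids j f

/-- The value of the Capelli polynomial:
`∑_σ sgn(σ) y_{σ 1} w_1 y_{σ 2} w_2 ⋯ y_{σ d} w_d`. -/
def capelli {A : Type*} [Ring A] {d : ℕ} (y w : Fin d → A) : A :=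
  ∑ σ : Equiv.Perm (Fin d),
    (Equiv.Perm.sign σ : ℤ) • (List.ofFn fun j => y (σ j) * w j).prod

/-- The Capelli polynomial in the indeterminates `x_{y 1}, …, x_{y d}` (the alternating ones)
and `x_{w 1}, …, x_{w d}`. -/
def capelliPoly (F : Type*) [Field F] {d : ℕ} (y w : Fin d → ℕ) : NCPoly F :=
  capelli (fun j => X F (y j)) (fun j => X F (w j))

/-- The indices of the alternating indeterminates, as a finite set. -/
def idx {d : ℕ} (y : Fin d → ℕ) : Finset ℕ := Finset.univ.image y

/-- The `k`-th coefficient operation on polynomials, with respect to the indeterminates in `Y` and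
to the polynomial `a`: the sum, over the `k`-element subsets `S` of `Y`, of the results of
replacing `x_j` by `a x_j` for all `j ∈ S`. -/
def coeffPoly {F : Type*} [Field F] (Y : Finset ℕ) (k : ℕ) (a : NCPoly F) (f : NCPoly F) :
    NCPoly F :=
  ∑ S ∈ Y.powersetCard k, FreeAlgebra.lift F (fun j => if j ∈ S then a * X F j else X F j) f

/-- Successive coefficient operations; the pair `(c, k)` stands for the `k`-th one with respect
to `x_c`. -/
def coeffWord {F : Type*} [Field F] (Y : Finset ℕ) (L : List (ℕ × ℕ)) (f : NCPoly F) : NCPoly F :=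
  L.foldr (fun s g => coeffPoly Y s.2 (X F s.1) g) f

/-- `C` is the commutator of two coefficient operations, applied to the Capelli polynomial `c_{m²}`
or to a polynomial obtained from it by coefficient operations; `l` lists the indeterminates. -/
def IsOperatorCommutator {F : Type*} [Field F] (m : ℕ) (l : List ℕ) (C : NCPoly F) : Prop :=
  ∃ (y w : Fin (m ^ 2) → ℕ) (a b k k' : ℕ) (L : List (ℕ × ℕ)),
    l = a :: b :: (List.ofFn y ++ List.ofFn w ++ L.map Prod.fst) ∧
    C = coeffPoly (idx y) k (X F a)
          (coeffPoly (idx y) k' (X F b) (coeffWord (idx y) L (capelliPoly F y w)))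
      - coeffPoly (idx y) k' (X F b)
          (coeffPoly (idx y) k (X F a) (coeffWord (idx y) L (capelliPoly F y w)))

/-- `C` is the commutator of the Capelli-bonded expressions `c_{m²}(y) v c_{m²}(y)` and
`c_{m²}(α y) v c_{m²}(α y)`, where `c_{m²}(α y)` is the result of a coefficient operation. -/
def IsBondCommutator {F : Type*} [Field F] (m : ℕ) (l : List ℕ) (C : NCPoly F) : Prop :=
  ∃ (y w w' : Fin (m ^ 2) → ℕ) (a v k : ℕ) (E E' : NCPoly F),
    l = a :: v :: (List.ofFn y ++ List.ofFn w ++ List.ofFn w') ∧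
    E = capelliPoly F y w * X F v * capelliPoly F y w' ∧
    E' = coeffPoly (idx y) k (X F a) (capelliPoly F y w) * X F v *
      coeffPoly (idx y) k (X F a) (capelliPoly F y w') ∧
    C = E * E' - E' * E

/-- `f'` is obtained from `f` by a commutator hike of matrix degree `m` at `x_i`: the indeterminate
`x_i` is replaced by `z C x_i`, where `C` is a commutator of one of the two kinds above and the
indeterminates of `z` and `C` are new. -/
def IsCommutatorHike {F : Type*} [Field F] (m i : ℕ) (f f' : NCPoly F) : Prop :=
  ∃ (z : ℕ) (l : List ℕ) (C : NCPoly F), Fresh i f (z :: l) ∧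
    (IsOperatorCommutator m l C ∨ IsBondCommutator m l C) ∧
    f' = subst i (X F z * C * X F i) f

/-- `m` is the degree of a diagonal (Wedderburn) block of `A ⊆ M_n(K)`: the `K`-algebra spanned by
`A` has `M_m(K)` as a simple quotient. -/
def IsBlockDegree {F K : Type*} [Field F] [Field K] [Algebra F K] {n : ℕ}
    (A : Subalgebra F (Matrix (Fin n) (Fin n) K)) (m : ℕ) : Prop :=
  0 < m ∧ ∃ π : Algebra.adjoin K (A : Set (Matrix (Fin n) (Fin n) K)) →ₐ[K]
    Matrix (Fin m) (Fin m) K, Function.Surjective π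

/-- The polynomially defined characteristic coefficient: the operator
`Φ ↦ ∑_S Φ(…, a^q v_j (j ∈ S), …, v_j (j ∉ S), …)`, the sum over the `k`-element subsets `S`
of `Y`, on `A`-valued functions of substitutions. -/
def alphaPol {A : Type*} [Ring A] (Y : Finset ℕ) (q k : ℕ) (a : A) (Φ : (ℕ → A) → A) :
    (ℕ → A) → A :=
  fun v => ∑ S ∈ Y.powersetCard k, Φ (fun j => if j ∈ S then a ^ q * v j else v j)

/-- The smallest space of functions that contains `Φ` and is stable under all the operators
`alphaPol Y q k a`. -/
def coeffModule (F : Type*) {A : Type*} [Field F] [Ring A] [Algebra F A] (Y : Finset ℕ)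
    (Φ : (ℕ → A) → A) : Submodule F ((ℕ → A) → A) :=
  sInf {M | Φ ∈ M ∧ ∀ (q k : ℕ) (a : A), ∀ Ψ ∈ M, alphaPol Y q k a Ψ ∈ M}

/-- The `k`-th characteristic coefficient of left multiplication by `a` on the `m²`-dimensional
space `M_m(K)`, that is, the `k`-th elementary symmetric function of its eigenvalues. -/
def charCoeff {K : Type*} [Field K] {m : ℕ} (k : ℕ) (a : Matrix (Fin m) (Fin m) K) : K :=
  (-1) ^ k * (LinearMap.mulLeft K a).charpoly.coeff (m ^ 2 - k)

theorem avoids_X {F : Type*} [Field F] {i j : ℕ} (h : j ≠ i) : Avoids i (X F j) :=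
  Algebra.subset_adjoin ⟨j, h, rfl⟩

theorem avoids_lift {F : Type*} [Field F] {i : ℕ} {φ : ℕ → NCPoly F}
    (hφ : ∀ j, j ≠ i → Avoids i (φ j)) {f : NCPoly F} (hf : Avoids i f) :
    Avoids i (FreeAlgebra.lift F φ f) := by
  unfold Avoids at hf
  induction hf using Algebra.adjoin_induction with
  | mem x hx =>
    obtain ⟨j, hj, rfl⟩ := hx
    rw [FreeAlgebra.lift_ι_apply]
    exact hφ j hj
  | algebraMap r => rw [AlgHom.commutes]; exact Subalgebra.algebraMap_mem _ r
  | add x y _ _ hx hy => rw [map_add]; exact Subalgebra.add_mem _ hx hy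
  | mul x y _ _ hx hy => rw [map_mul]; exact Subalgebra.mul_mem _ hx hy

theorem avoids_coeffPoly {F : Type*} [Field F] {i : ℕ} {a f : NCPoly F} (Y : Finset ℕ) (k : ℕ)
    (ha : Avoids i a) (hf : Avoids i f) : Avoids i (coeffPoly Y k a f) := by
  refine Subalgebra.sum_mem _ fun S _ => avoids_lift (fun j hj => ?_) hf
  split_ifs
  · exact Subalgebra.mul_mem _ ha (avoids_X hj)
  · exact avoids_X hj

theorem avoids_coeffWord {F : Type*} [Field F] {i : ℕ} {f : NCPoly F} (Y : Finset ℕ)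
    (L : List (ℕ × ℕ)) (hL : ∀ s ∈ L, s.1 ≠ i) (hf : Avoids i f) :
    Avoids i (coeffWord Y L f) := by
  induction L with
  | nil => exact hf
  | cons s L ih =>
    exact avoids_coeffPoly Y _ (avoids_X (hL s (by simp)))
      (ih fun t ht => hL t (List.mem_cons_of_mem _ ht))

theorem avoids_capelliPoly {F : Type*} [Field F] {i d : ℕ} {y w : Fin d → ℕ}
    (hy : ∀ j, y j ≠ i) (hw : ∀ j, w j ≠ i) : Avoids i (capelliPoly F y w) := by
  refine Subalgebra.sum_mem _ fun σ _ => Subalgebra.zsmul_mem _ (Subalgebra.list_prod_mem _ ?_) _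
  intro x hx
  obtain ⟨j, rfl⟩ := List.mem_ofFn.1 hx
  exact Subalgebra.mul_mem _ (avoids_X (hy _)) (avoids_X (hw _))

/-- A commutator hike is a hike. -/
theorem IsCommutatorHike.isHike {F : Type*} [Field F] {m i : ℕ} {f f' : NCPoly F}
    (h : IsCommutatorHike m i f f') : IsHike i f f' := by
  obtain ⟨z, l, C, hfr, hC, rfl⟩ := h
  have hz : z ≠ i := (hfr.2 z (by simp)).1
  have hl : ∀ j ∈ l, j ≠ i := fun j hj => (hfr.2 j (List.mem_cons_of_mem _ hj)).1
  have hCi : Avoids i C := by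
    rcases hC with ⟨y, w, a, b, k, k', L, rfl, rfl⟩ | ⟨y, w, w', a, v, k, E, E', rfl, rfl, rfl, rfl⟩
    · have ha : Avoids i (X F a) := avoids_X (hl a (by simp))
      have hb : Avoids i (X F b) := avoids_X (hl b (by simp))
      have hc : Avoids i (coeffWord (idx y) L (capelliPoly F y w)) := by
        refine avoids_coeffWord _ _ (fun s hs => hl _ ?_) (avoids_capelliPoly
          (fun j => hl _ (by simp)) (fun j => hl _ (by simp)))
        have : s.1 ∈ L.map Prod.fst := List.mem_map_of_mem hs
        simp only [List.mem_cons, List.mem_append]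
        tauto
      exact Subalgebra.sub_mem _
        (avoids_coeffPoly _ _ ha (avoids_coeffPoly _ _ hb hc))
        (avoids_coeffPoly _ _ hb (avoids_coeffPoly _ _ ha hc))
    · have ha : Avoids i (X F a) := avoids_X (hl a (by simp))
      have hv : Avoids i (X F v) := avoids_X (hl v (by simp))
      have hc : Avoids i (capelliPoly F y w) :=
        avoids_capelliPoly (fun j => hl _ (by simp)) (fun j => hl _ (by simp))
      have hc' : Avoids i (capelliPoly F y w') :=
        avoids_capelliPoly (fun j => hl _ (by simp)) (fun j => hl _ (by simp))
      have hE := Subalgebra.mul_mem _ (Subalgebra.mul_mem _ hc hv) hc'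
      have hE' := Subalgebra.mul_mem _ (Subalgebra.mul_mem _
        (avoids_coeffPoly (idx y) k ha hc) hv) (avoids_coeffPoly (idx y) k ha hc')
      exact Subalgebra.sub_mem _ (Subalgebra.mul_mem _ hE hE') (Subalgebra.mul_mem _ hE' hE)
  refine ⟨_, Submodule.subset_span ⟨X F z * C, 1, ?_, Subalgebra.one_mem _, ?_⟩, rfl⟩
  · exact Subalgebra.mul_mem _ (avoids_X hz) hCi
  · rw [mul_one]

end Hiking

end

noncomputable section

namespace Hiking

open Module Matrix

/-! Fix `m`. Let `N` be `capelliIdeal A m`, generated by the values of `c_{d²}` for block degrees `d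
> m`, and let `P` be `smallBlocksKernel A m`, the elements of `A` that vanish in all blocks of
degree at most `m`. Take `m` minimal such that commutator hikes lead from `f` to a non-identity
vanishing on the generators of `N`. By minimality, `m` is a block degree, and no non-identity
reached in this way vanishes on all products `z c_{m²}(y;w) x`.

Hikes of degree `m` terminate for two reasons. First, on `M_m(K)` a coefficient operation multiplies
`c_{m²}` by a scalar (`coeffOp_capelli`), while `c_{m²}` vanishes on smaller matrices; hence every
commutator value of degree `m` lies in `P`, and `s` successive hikes insert a product from `P ^ s`
(`NonvanishingOnPow.of_hike`). Second, some `P ^ s` lies in the Zariski closure of `N`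
(`exists_smallBlocksKernel_pow_le`), where the hiked polynomials vanish, because they are additive
in `x_i` and their values are polynomial in the matrix entries.

The Zariski closure stands in for the `K`-span of `N` since quasi-linearity gives no `K`-linearity.
Wedderburn theory only puts a power of `P` into the `K`-span. To pass to the closure, take an
idempotent `e` of the closure whose complementary corner is nil (`exists_maximal_idempotent`); by
Levitzki's theorem that corner spans a nilpotent algebra, and modulo the closure each element of `A`
agrees with its corner part (`exists_pow_le_closure`).

Once every degree `m` hike of `g` is an identity, `g` vanishes whenever `x_i` takes a value `b c x`
with `c` a commutator value. The value of `h` is an additive function of the value of `c_{m²}` that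
kills all commutator values, so the coefficient operators commute
(`alphaPol_comm_of_mem_coeffModule`). -/

/-! ### Vanishing and nonvanishing of Capelli polynomials. -/

/-- The Capelli polynomial as an alternating map in its alternating arguments. -/
def capelliAlternating (R : Type*) {A : Type*} [CommRing R] [Ring A] [Algebra R A] {d : ℕ}
    (w : Fin d → A) : A [⋀^Fin d]→ₗ[R] A :=
  MultilinearMap.alternatization ((MultilinearMap.mkPiAlgebraFin R d A).compLinearMap
    fun j => LinearMap.mulRight R (w j))

theorem capelliAlternating_apply (R : Type*) {A : Type*} [CommRing R] [Ring A] [Algebra R A]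
    {d : ℕ} (y w : Fin d → A) : capelliAlternating R w y = capelli y w := by
  simp [capelliAlternating, capelli, MultilinearMap.alternatization_apply, Units.smul_def]

/-- The Capelli polynomial as a multilinear map in its separating arguments. -/
def capelliMultilinear (R : Type*) {A : Type*} [CommRing R] [Ring A] [Algebra R A] {d : ℕ}
    (y : Fin d → A) : MultilinearMap R (fun _ : Fin d => A) A :=
  ∑ σ : Equiv.Perm (Fin d), (Equiv.Perm.sign σ : ℤ) •
    (MultilinearMap.mkPiAlgebraFin R d A).compLinearMap fun j => LinearMap.mulLeft R (y (σ j))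

theorem capelliMultilinear_apply (R : Type*) {A : Type*} [CommRing R] [Ring A] [Algebra R A]
    {d : ℕ} (y w : Fin d → A) : capelliMultilinear R y w = capelli y w := by
  simp [capelliMultilinear, capelli]

theorem map_capelli {A B G : Type*} [Ring A] [Ring B] [FunLike G A B] [RingHomClass G A B]
    (φ : G) {d : ℕ} (y w : Fin d → A) :
    φ (capelli y w) = capelli (fun j => φ (y j)) (fun j => φ (w j)) := by
  simp [capelli, map_sum, map_list_prod, List.map_ofFn, Function.comp_def]

/-- The Capelli polynomial vanishes when there are more alternating arguments than dimensions. -/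
theorem capelli_eq_zero_of_finrank_lt (K : Type*) {A : Type*} [Field K] [Ring A] [Algebra K A]
    [FiniteDimensional K A] {d : ℕ} (h : finrank K A < d) (y w : Fin d → A) :
    capelli y w = 0 := by
  rw [← capelliAlternating_apply K]
  refine AlternatingMap.map_linearDependent _ y fun hli => ?_
  have := hli.fintype_card_le_finrank
  simp at this
  omega

/-- A Capelli polynomial that vanishes on a spanning set vanishes identically. -/
theorem capelli_eq_zero_of_span {K A : Type*} [Field K] [Ring A] [Algebra K A]
    {S : Set A} (hS : Submodule.span K S = ⊤) {d : ℕ}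
    (h : ∀ y w : Fin d → A, (∀ j, y j ∈ S) → (∀ j, w j ∈ S) → capelli y w = 0)
    (y w : Fin d → A) : capelli y w = 0 := by
  obtain ⟨b, hbS, hb, hli⟩ := exists_linearIndependent K S
  have he : ∃ e : Basis b K A, ∀ j, e j = j.1 := ⟨Basis.mk hli (by simp [hb, hS]), by simp⟩
  obtain ⟨e, he⟩ := he
  have h1 : ∀ y : Fin d → A, (∀ j, y j ∈ S) → ∀ w, capelli y w = 0 := by
    intro y hy w
    have : capelliMultilinear K y = 0 := by
      refine Basis.ext_multilinear (fun _ => e) fun v => ?_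
      rw [capelliMultilinear_apply]
      exact h _ _ hy fun j => by rw [he]; exact hbS (v j).2
    rw [← capelliMultilinear_apply K, this]; rfl
  have : (capelliAlternating K w).toMultilinearMap = 0 := by
    refine Basis.ext_multilinear (fun _ => e) fun v => ?_
    change capelliAlternating K w _ = 0
    rw [capelliAlternating_apply]
    exact h1 _ (fun j => by rw [he]; exact hbS (v j).2) _
  rw [← capelliAlternating_apply K]
  exact congrFun (congrArg DFunLike.coe this) y

/-- A product of matrix units survives only along a connected path. The column `r j.succ` of factor
`j` must be the row `s (j + 1)` of the next one, so connectedness is the condition `s j = r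
j.castSucc` at each `j`. -/
theorem prod_single_apply {K ι : Type*} [Field K] [Fintype ι] [DecidableEq ι] {N : ℕ}
    (r : Fin (N + 1) → ι) (s : Fin N → ι) (c : Fin N → K) :
    (List.ofFn fun j => Matrix.single (s j) (r j.succ) (c j)).prod (r 0) (r (Fin.last N)) =
      ∏ j, if s j = r j.castSucc then c j else 0 := by
  induction N with
  | zero => simp
  | succ N ih =>
    rw [List.ofFn_succ, List.prod_cons, Fin.prod_univ_succ, Fin.castSucc_zero]
    have := ih (fun j => r j.succ) (fun j => s j.succ) (fun j => c j.succ)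
    simp only [Fin.succ_last, Fin.succ_castSucc] at this ⊢
    rw [← this, Fin.succ_zero_eq_one]
    by_cases h : s 0 = r 0
    · rw [if_pos h, ← h, Matrix.single_mul_apply_same]
    · rw [if_neg h, Matrix.single_mul_apply_of_ne (h := Ne.symm h), zero_mul]

/-- The Capelli polynomial `c_{d²}` does not vanish on `d × d` matrices. -/
theorem exists_capelli_ne_zero (K : Type*) [Field K] {d : ℕ} (hd : 0 < d) :
    ∃ y w : Fin (d ^ 2) → Matrix (Fin d) (Fin d) K, capelli y w ≠ 0 := by
  have e : Fin (d ^ 2) ≃ Fin d × Fin d := Fintype.equivOfCardEq (by simp [sq])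
  -- The separating matrix units join the column of one `y j` to the row of the next, so the
  -- identity order is a path; its last endpoint `0` is arbitrary. For `σ ≠ 1`, some `y (σ j)` has
  -- the wrong row or column and breaks the path.
  let r : Fin (d ^ 2 + 1) → Fin d := Fin.snoc (fun j => (e j).1) ⟨0, hd⟩
  refine ⟨fun j => Matrix.single (e j).1 (e j).2 1, fun j => Matrix.single (e j).2 (r j.succ) 1,
    fun h => ?_⟩
  have h' := congrFun (congrFun h (r 0)) (r (Fin.last _))
  rw [capelli, Matrix.sum_apply, Finset.sum_eq_single 1] at h'
  · simp only [Equiv.Perm.sign_one, Equiv.Perm.coe_one, id] at h'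
    simp only [Matrix.single_mul_single_same, mul_one, Units.val_one, one_smul] at h'
    rw [prod_single_apply] at h'
    simp [r] at h'
  · intro σ _ hσ
    rw [Matrix.smul_apply]
    have : ∀ j, Matrix.single (e (σ j)).1 (e (σ j)).2 (1 : K) *
        Matrix.single (e j).2 (r j.succ) 1 =
        Matrix.single (e (σ j)).1 (r j.succ) (if (e (σ j)).2 = (e j).2 then 1 else 0) := by
      intro j
      split_ifs with hj
      · rw [hj, Matrix.single_mul_single_same, mul_one]
      · rw [Matrix.single_mul_single_of_ne (h := hj), Matrix.single_zero]
    simp only [this, prod_single_apply]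
    obtain ⟨j, hj⟩ : ∃ j, σ j ≠ j := by
      by_contra! hc
      exact hσ (Equiv.ext hc)
    rw [Finset.prod_eq_zero (Finset.mem_univ j), smul_zero]
    split_ifs with h1 h2
    · simp only [r, Fin.snoc_castSucc] at h1
      exact absurd (e.injective (Prod.ext h1 h2)) hj
    · rfl
    · rfl
  · simp

/-! ### Coefficient operations and characteristic coefficients. -/

/-- The sum of the values of `Ψ` after multiplication of `k` of its arguments by `a`. -/
def coeffOp {A R : Type*} [Mul A] [AddCommMonoid R] {N : ℕ} (k : ℕ) (a : A)
    (Ψ : (Fin N → A) → R) : (Fin N → A) → R :=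
  fun Y => ∑ S ∈ (Finset.univ : Finset (Fin N)).powersetCard k,
    Ψ fun j => if j ∈ S then a * Y j else Y j

/-- An alternating form in `dim V` arguments is scaled by `det U` when `U` is applied to all of
them. Take `U = s - T`, expand multilinearly, and compare coefficients of powers of `s` with those
of the characteristic polynomial. -/
theorem sum_powersetCard_alternating {K V : Type*} [Field K] [Infinite K] [AddCommGroup V]
    [Module K V] [FiniteDimensional K V] {N k : ℕ} (hN : finrank K V = N) (hk : k ≤ N)
    (D : V [⋀^Fin N]→ₗ[K] K) (T : V →ₗ[K] V) (y : Fin N → V) :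
    ∑ S ∈ (Finset.univ : Finset (Fin N)).powersetCard k,
      D (fun j => if j ∈ S then T (y j) else y j) =
      (-1) ^ k * T.charpoly.coeff (N - k) * D y := by
  classical
  let e : Basis (Fin N) K V := finBasisOfFinrankEq K V hN
  have hD : ∀ U : V →ₗ[K] V, D (fun j => U (y j)) = LinearMap.det U * D y := by
    intro U
    rw [D.eq_smul_basis_det e, AlternatingMap.smul_apply, AlternatingMap.smul_apply]
    have := Basis.det_comp e U y
    simp only [Function.comp_def] at this
    rw [this, smul_eq_mul, smul_eq_mul]; ring
  let q : Polynomial K := ∑ S : Finset (Fin N), Polynomial.C ((-1) ^ S.card *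
    D (fun j => if j ∈ S then T (y j) else y j)) * Polynomial.X ^ (N - S.card)
  have hq : q = Polynomial.C (D y) * T.charpoly := by
    refine Polynomial.funext fun s => ?_
    rw [Polynomial.eval_mul, Polynomial.eval_C, LinearMap.eval_charpoly, mul_comm, ← hD]
    have : (fun j => (algebraMap K (End K V) s - T) (y j)) =
        (fun j => -(T (y j))) + fun j => s • y j := by
      ext j
      simp [sub_eq_add_neg, add_comm]
    rw [this, ← AlternatingMap.coe_multilinearMap, MultilinearMap.map_add_univ]
    simp only [q, Polynomial.eval_finsetSum, Polynomial.eval_mul, Polynomial.eval_C,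
      Polynomial.eval_pow, Polynomial.eval_X]
    refine Finset.sum_congr rfl fun S _ => ?_
    have h2 : S.piecewise (fun j => -(T (y j))) (fun j => s • y j) =
        fun j => (if j ∈ S then (-1 : K) else s) • (if j ∈ S then T (y j) else y j) := by
      ext j
      by_cases hj : j ∈ S <;> simp [hj]
    rw [h2, MultilinearMap.map_smul_univ, Finset.prod_ite, Finset.prod_const, Finset.prod_const]
    have h3 : (Finset.univ.filter fun j => j ∉ S).card = N - S.card := by
      rw [Finset.filter_not, Finset.card_sdiff_of_subset (Finset.filter_subset _ _)]
      simp
    rw [h3]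
    simp
    ring
  have hc := congrArg (fun P : Polynomial K => P.coeff (N - k)) hq
  simp only [q, Polynomial.finsetSum_coeff, Polynomial.coeff_C_mul, Polynomial.coeff_X_pow] at hc
  rw [mul_assoc, mul_comm (T.charpoly.coeff _), ← hc, Finset.mul_sum,
    Finset.powersetCard_eq_filter, Finset.sum_filter, Finset.powerset_univ]
  refine Finset.sum_congr rfl fun S _ => ?_
  have hS : S.card ≤ N := by simpa using S.card_le_univ
  by_cases h : S.card = k
  · rw [if_pos h, h, if_pos rfl, mul_one, ← mul_assoc, ← mul_pow]
    simp
  · rw [if_neg h, if_neg (by omega)]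
    simp

/-- On `M_m(K)` the coefficient operations are the characteristic coefficients. -/
theorem coeffOp_capelli {K : Type*} [Field K] [Infinite K] {m k : ℕ} (hk : k ≤ m ^ 2)
    (a : Matrix (Fin m) (Fin m) K) (w : Fin (m ^ 2) → Matrix (Fin m) (Fin m) K) :
    coeffOp k a (fun Y => capelli Y w) = charCoeff k a • fun Y => capelli Y w := by
  funext Y
  ext s t
  have := sum_powersetCard_alternating (K := K) (V := Matrix (Fin m) (Fin m) K) (N := m ^ 2)
    (by simp [Module.finrank_matrix, sq]) hk
    ((Matrix.entryLinearMap K K s t).compAlternatingMap (capelliAlternating K w))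
    (LinearMap.mulLeft K a) Y
  simpa [coeffOp, charCoeff, Matrix.sum_apply, capelliAlternating_apply] using this

theorem coeffOp_of_lt {A R : Type*} [Mul A] [AddCommMonoid R] {N k : ℕ} (h : N < k) (a : A)
    (Ψ : (Fin N → A) → R) : coeffOp k a Ψ = 0 := by
  funext Y
  rw [coeffOp, Finset.powersetCard_eq_empty.2 (by simpa using h), Finset.sum_empty]; rfl

theorem coeffOp_smul {K A R : Type*} [Mul A] [AddCommMonoid R] [Monoid K]
    [DistribMulAction K R] {N k : ℕ} (a : A) (c : K) (Ψ : (Fin N → A) → R) :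
    coeffOp k a (c • Ψ) = c • coeffOp k a Ψ := by
  funext Y
  simp [coeffOp, Finset.smul_sum]

theorem coeffOp_comp {A R R' G : Type*} [Mul A] [AddCommMonoid R] [AddCommMonoid R']
    [FunLike G R R'] [AddMonoidHomClass G R R'] {N k : ℕ} (a : A) (φ : G)
    (Ψ : (Fin N → A) → R) :
    coeffOp k a (fun Y => φ (Ψ Y)) = fun Y => φ (coeffOp k a Ψ Y) := by
  funext Y
  simp [coeffOp, map_sum]

/-- After the injective substitution `X ↦ X ^ p ^ r`, both sides become `det (X - M) ^ p ^ r`,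
because `X` commutes with `M` and so `(X - M) ^ p ^ r = X ^ p ^ r - M ^ p ^ r`. -/
theorem charpoly_pow_char_pow (p : ℕ) [Fact p.Prime] {K : Type*} [Field K] [CharP K p]
    {n : Type*} [DecidableEq n] [Fintype n] (M : Matrix n n K) (r : ℕ) :
    (M ^ p ^ r).charpoly = M.charpoly.map (iterateFrobenius K p r) := by
  have hp : 0 < p ^ r := pow_pos (Fact.out : p.Prime).pos r
  cases (isEmpty_or_nonempty n).symm
  · refine Polynomial.expand_injective hp ?_
    have : Polynomial.expand K (p ^ r) (M.charpoly.map (iterateFrobenius K p r)) =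
        M.charpoly ^ p ^ r := by
      rw [← Polynomial.map_expand, Polynomial.map_iterateFrobenius_expand]
    rw [this]
    unfold Matrix.charpoly
    rw [AlgHom.map_det, ← Matrix.coe_detMonoidHom,
      ← (Matrix.detMonoidHom : Matrix n n (Polynomial K) →* Polynomial K).map_pow]
    apply congr_arg Matrix.det
    refine matPolyEquiv.injective ?_
    rw [map_pow, Matrix.matPolyEquiv_charmatrix, sub_pow_char_pow_of_commute, ← Polynomial.C_pow]
    · exact (id (matPolyEquiv_eq_X_pow_sub_C (p ^ r) M) :)
    · exact (Polynomial.C M).commute_X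
  · rw [Subsingleton.elim (M ^ p ^ r) M, Matrix.charpoly_isEmpty]; simp

theorem charCoeff_pow_char_pow (p : ℕ) [Fact p.Prime] {K : Type*} [Field K] [CharP K p] {m : ℕ}
    (a : Matrix (Fin m) (Fin m) K) (r k : ℕ) :
    charCoeff k (a ^ p ^ r) = charCoeff k a ^ p ^ r := by
  have h : (LinearMap.mulLeft K (a ^ p ^ r)).charpoly =
      (LinearMap.mulLeft K a).charpoly.map (iterateFrobenius K p r) := by
    let b := Module.finBasis K (Matrix (Fin m) (Fin m) K)
    rw [← LinearMap.charpoly_toMatrix _ b, ← LinearMap.charpoly_toMatrix _ b,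
      ← charpoly_pow_char_pow, ← LinearMap.pow_mulLeft, LinearMap.toMatrix_pow]
  rw [charCoeff, charCoeff, h, Polynomial.coeff_map, iterateFrobenius_def, mul_pow, ← pow_mul,
    mul_comm k, pow_mul]
  congr 2
  rw [← iterateFrobenius_def, map_neg, map_one]

/-! ### Zariski closures of sets of matrices. -/

section Zariski

variable {K : Type*} [Field K] {n : ℕ}

/-- The Zariski closure of a set of matrices. -/
def zariskiClosure (S : Set (Matrix (Fin n) (Fin n) K)) : Set (Matrix (Fin n) (Fin n) K) :=
  {x | ∀ φ : MvPolynomial (Fin n × Fin n) K,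
    (∀ s ∈ S, MvPolynomial.eval (fun t => s t.1 t.2) φ = 0) →
      MvPolynomial.eval (fun t => x t.1 t.2) φ = 0}

/-- A map between matrix spaces whose entries are polynomials. -/
def IsPolyMap (T : Matrix (Fin n) (Fin n) K → Matrix (Fin n) (Fin n) K) : Prop :=
  ∀ i j, ∃ φ : MvPolynomial (Fin n × Fin n) K,
    ∀ x : Matrix (Fin n) (Fin n) K, T x i j = MvPolynomial.eval (fun t => x t.1 t.2) φ

theorem IsPolyMap.id : IsPolyMap (fun x : Matrix (Fin n) (Fin n) K => x) :=
  fun i j => ⟨MvPolynomial.X (i, j), fun x => by simp⟩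

theorem IsPolyMap.const (c : Matrix (Fin n) (Fin n) K) : IsPolyMap (fun _ => c) :=
  fun i j => ⟨MvPolynomial.C (c i j), fun x => by simp⟩

theorem IsPolyMap.add {T U : Matrix (Fin n) (Fin n) K → Matrix (Fin n) (Fin n) K}
    (hT : IsPolyMap T) (hU : IsPolyMap U) : IsPolyMap (fun x => T x + U x) := by
  intro i j
  obtain ⟨φ, hφ⟩ := hT i j
  obtain ⟨ψ, hψ⟩ := hU i j
  exact ⟨φ + ψ, fun x => by simp [hφ, hψ]⟩

theorem IsPolyMap.mul {T U : Matrix (Fin n) (Fin n) K → Matrix (Fin n) (Fin n) K}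
    (hT : IsPolyMap T) (hU : IsPolyMap U) : IsPolyMap (fun x => T x * U x) := by
  intro i j
  choose φ hφ using hT
  choose ψ hψ using hU
  exact ⟨∑ k, φ i k * ψ k j, fun x => by simp [Matrix.mul_apply, hφ, hψ]⟩

theorem subset_zariskiClosure (S : Set (Matrix (Fin n) (Fin n) K)) : S ⊆ zariskiClosure S :=
  fun _ hx _ hφ => hφ _ hx

theorem IsPolyMap.mem_closure {T : Matrix (Fin n) (Fin n) K → Matrix (Fin n) (Fin n) K}
    (hT : IsPolyMap T) {S S' : Set (Matrix (Fin n) (Fin n) K)}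
    (h : ∀ s ∈ S, T s ∈ zariskiClosure S') {x : Matrix (Fin n) (Fin n) K}
    (hx : x ∈ zariskiClosure S) : T x ∈ zariskiClosure S' := by
  intro φ hφ
  choose ψ hψ using hT
  have key : ∀ y, MvPolynomial.eval (fun t : Fin n × Fin n => T y t.1 t.2) φ =
      MvPolynomial.eval (fun t => y t.1 t.2) (MvPolynomial.bind₁ (fun t => ψ t.1 t.2) φ) := by
    intro y
    simp only [hψ]
    exact (MvPolynomial.eval₂Hom_bind₁ _ _ _ φ).symm
  rw [key]
  refine hx _ fun s hs => ?_
  rw [← key]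
  exact h s hs φ hφ

theorem IsPolyMap.eq_zero {T : Matrix (Fin n) (Fin n) K → Matrix (Fin n) (Fin n) K}
    (hT : IsPolyMap T) {S : Set (Matrix (Fin n) (Fin n) K)}
    (h : ∀ s ∈ S, T s = 0) {x : Matrix (Fin n) (Fin n) K}
    (hx : x ∈ zariskiClosure S) : T x = 0 := by
  ext i j
  obtain ⟨φ, hφ⟩ := hT i j
  rw [hφ]
  exact hx φ fun s hs => by rw [← hφ, h s hs]; rfl

theorem zariskiClosure_subset {S S' : Set (Matrix (Fin n) (Fin n) K)}
    (h : S ⊆ zariskiClosure S') : zariskiClosure S ⊆ zariskiClosure S' :=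
  fun _ hx => IsPolyMap.id.mem_closure (fun _ hs => h hs) hx

theorem isPolyMap_eval {F : Type*} [Field F] [Algebra F K]
    (v : ℕ → Matrix (Fin n) (Fin n) K) (i : ℕ) (f : NCPoly F) :
    IsPolyMap (fun x => eval (Function.update v i x) f) := by
  induction f using FreeAlgebra.induction with
  | grade0 r => simpa [eval] using IsPolyMap.const _
  | grade1 j =>
    simp only [eval, FreeAlgebra.lift_ι_apply]
    by_cases h : j = i
    · subst h; simpa using IsPolyMap.id
    · simpa [Function.update_of_ne h] using IsPolyMap.const _
  | mul a b ha hb => simpa [eval] using ha.mul hb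
  | add a b ha hb => simpa [eval] using ha.add hb

/-- Some power of a matrix is divisible by all higher powers. -/
theorem exists_pow_eq_pow_mul (a : Matrix (Fin n) (Fin n) K) :
    -- Write the minimal polynomial as `X ^ r * q` with `q(0) ≠ 0`; the relation `a ^ r * q(a) = 0`
    -- can be solved for `a ^ r`.
    ∃ (c : Matrix (Fin n) (Fin n) K) (r : ℕ), Commute a c ∧ a ^ r = a ^ (r + 1) * c := by
  have h0 : minpoly K a ≠ 0 := minpoly.ne_zero (Algebra.IsIntegral.isIntegral a)
  obtain ⟨q, hq, hd⟩ := Polynomial.exists_eq_pow_rootMultiplicity_mul_and_not_dvd _ h0 0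
  rw [Polynomial.C_0, sub_zero] at hq hd
  rw [Polynomial.X_dvd_iff] at hd
  set r := Polynomial.rootMultiplicity 0 (minpoly K a)
  have h1 : a ^ r * Polynomial.aeval a q = 0 := by
    have := minpoly.aeval K a
    rw [hq] at this
    simpa using this
  have h2 : Polynomial.aeval a q =
      a * Polynomial.aeval a q.divX + algebraMap K _ (q.coeff 0) := by
    have := congrArg (Polynomial.aeval a) (Polynomial.X_mul_divX_add q)
    rw [map_add, map_mul, Polynomial.aeval_X, Polynomial.aeval_C] at this
    exact this.symm
  refine ⟨-((q.coeff 0)⁻¹ • Polynomial.aeval a q.divX), r, ?_, ?_⟩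
  · refine ((Commute.smul_right ?_ _).neg_right)
    simpa using (Polynomial.commute_X q.divX).map (Polynomial.aeval a)
  · have h3 : a ^ r * (a * Polynomial.aeval a q.divX) = - (q.coeff 0 • a ^ r) := by
      rw [h2, mul_add, Algebra.algebraMap_eq_smul_one, mul_smul_comm, mul_one] at h1
      exact eq_neg_of_add_eq_zero_left h1
    rw [pow_succ, mul_assoc, mul_neg, mul_neg, mul_smul_comm, mul_smul_comm, h3, smul_neg, neg_neg,
      smul_smul, inv_mul_cancel₀ hd, one_smul]

/-- The Zariski closure of the powers of a matrix that is not nilpotent contains a nonzero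
idempotent. -/
theorem exists_idempotent_mem_closure {a : Matrix (Fin n) (Fin n) K} (ha : ¬ IsNilpotent a) :
    ∃ ε ∈ zariskiClosure {x | ∃ k : ℕ, x = a ^ (k + 1)}, ε ≠ 0 ∧ ε * ε = ε := by
  obtain ⟨c, r, hc, hr⟩ := exists_pow_eq_pow_mul a
  have hstep : ∀ j k : ℕ, r ≤ k → c ^ j * a ^ (j + k) = a ^ k := by
    intro j
    induction j with
    | zero => intro k _; simp
    | succ j ih =>
      intro k hk
      have h1 : a ^ (k + 1) * c = a ^ k := by
        obtain ⟨t, rfl⟩ := Nat.exists_eq_add_of_le' hk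
        rw [add_assoc, pow_add, mul_assoc, ← hr, ← pow_add]
      rw [pow_succ', mul_assoc, show j + 1 + k = j + (k + 1) by ring, ih (k + 1) (by omega),
        ← (hc.pow_left (k + 1)).eq, h1]
  have hrr : ∀ k, r ≤ k → c ^ k * a ^ k = c ^ r * a ^ r := by
    intro k hk
    obtain ⟨t, rfl⟩ := Nat.exists_eq_add_of_le hk
    rw [pow_add c, mul_assoc, add_comm r t, hstep t r le_rfl]
  -- The ideals of the tails `{a ^ j | k ≤ j}` increase with `k`, hence stabilize; so for large `s`
  -- the matrix `a ^ s` lies in the closure of the powers from `2 * s` on.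
  let I : ℕ →o Ideal (MvPolynomial (Fin n × Fin n) K) :=
    { toFun := fun k =>
        { carrier := {φ | ∀ j, k ≤ j → MvPolynomial.eval (fun t => (a ^ j) t.1 t.2) φ = 0}
          add_mem' := fun {x y} hx hy j hj => by simp [hx j hj, hy j hj]
          zero_mem' := fun j _ => by simp
          smul_mem' := fun x y hy j hj => by simp [hy j hj] }
      monotone' := fun k l hkl φ hφ j hj => hφ j (hkl.trans hj) }
  obtain ⟨k0, hk0⟩ := monotone_stabilizes_iff_noetherian.2
    (inferInstance : IsNoetherianRing (MvPolynomial (Fin n × Fin n) K)) I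
  let s := max (max k0 r) 1
  have hs : I s = I (2 * s) := by
    rw [← hk0 s (by simp [s]), ← hk0 (2 * s) (by omega)]
  have hmem : a ^ s ∈ zariskiClosure {x | ∃ j, 2 * s ≤ j ∧ x = a ^ j} := by
    intro φ hφ
    have : φ ∈ I (2 * s) := fun j hj => hφ _ ⟨j, hj, rfl⟩
    rw [← hs] at this
    exact this s le_rfl
  -- This is the Fitting idempotent of `a`. Multiplication by `c ^ s` lowers exponents `j ≥ 2 * s`
  -- by `s`; as `s ≥ 1`, only positive powers of `a` result.
  refine ⟨c ^ s * a ^ s, ?_, ?_, ?_⟩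
  · refine ((IsPolyMap.const (c ^ s)).mul IsPolyMap.id).mem_closure ?_ hmem
    rintro _ ⟨j, hj, rfl⟩
    obtain ⟨t, rfl⟩ := Nat.exists_eq_add_of_le hj
    refine subset_zariskiClosure _ ⟨s + t - 1, ?_⟩
    rw [show 2 * s + t = s + (s + t) by ring, hstep s (s + t) (by omega)]
    congr 1; omega
  · intro h0
    refine ha ⟨s, ?_⟩
    rw [← hstep s s (by omega), pow_add, ← mul_assoc, h0, zero_mul]
  · have hcc : Commute (a ^ s) (c ^ s) := hc.pow_pow s s
    calc c ^ s * a ^ s * (c ^ s * a ^ s) = c ^ s * (c ^ s * a ^ (s + s)) := by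
          rw [mul_assoc, ← mul_assoc (a ^ s), hcc.eq, mul_assoc, pow_add]
      _ = c ^ s * a ^ s := by rw [hstep s s (by omega)]

end Zariski

/-! ### Nilpotency from Wedderburn theory and Levitzki's theorem. -/

section Radical

/-- Elements killed by all maps onto matrix algebras that kill `I` are nilpotent modulo `I`. -/
theorem exists_pow_le_of_killed {K U : Type*} [Field K] [IsAlgClosed K] [Ring U] [Algebra K U]
    [FiniteDimensional K U] (I : Ideal U) [I.IsTwoSided] (P : Submodule K U)
    (hP : ∀ (d : ℕ) (π : U →ₐ[K] Matrix (Fin d) (Fin d) K), 0 < d → Function.Surjective π →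
      (∀ x ∈ I, π x = 0) → ∀ x ∈ P, π x = 0) :
    ∃ s : ℕ, P ^ s ≤ I.restrictScalars K := by
  have : IsArtinianRing (U ⧸ I) := IsArtinianRing.of_finite K (U ⧸ I)
  obtain ⟨s, hs⟩ := IsSemiprimaryRing.isNilpotent (R := U ⧸ I)
  have hJ : ∀ x ∈ P, Ideal.Quotient.mk I x ∈ Ring.jacobson (U ⧸ I) := by
    intro x hx
    -- The coordinates of the semisimple quotient are surjections onto matrix algebras that kill
    -- `I`. By hypothesis they kill `P`, which therefore lies in the radical modulo `I`; that
    -- radical is nilpotent.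
    obtain ⟨N, d, hd, ⟨e⟩⟩ := IsSemisimpleRing.exists_algEquiv_pi_matrix_of_isAlgClosed K
      ((U ⧸ I) ⧸ Ring.jacobson (U ⧸ I))
    rw [← Ideal.Quotient.eq_zero_iff_mem, ← map_eq_zero_iff e e.injective]
    funext t
    let π : U →ₐ[K] Matrix (Fin (d t)) (Fin (d t)) K :=
      (Pi.evalAlgHom K (fun t => Matrix (Fin (d t)) (Fin (d t)) K) t).comp
        (e.toAlgHom.comp ((Ideal.Quotient.mkₐ K (Ring.jacobson (U ⧸ I))).comp
          (Ideal.Quotient.mkₐ K I)))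
    refine hP (d t) π (NeZero.pos _) ?_ ?_ x hx
    · exact (Function.surjective_eval t).comp (e.surjective.comp
        ((Ideal.Quotient.mkₐ_surjective K _).comp (Ideal.Quotient.mkₐ_surjective K _)))
    · intro y hy
      have : Ideal.Quotient.mk I y = 0 := Ideal.Quotient.eq_zero_iff_mem.2 hy
      change e (Ideal.Quotient.mk _ (Ideal.Quotient.mk I y)) t = 0
      rw [this, map_zero, map_zero]; rfl
  have hpow : ∀ k : ℕ, ∀ x ∈ P ^ k, Ideal.Quotient.mk I x ∈ Ring.jacobson (U ⧸ I) ^ k := by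
    intro k
    induction k with
    | zero => intro x _; rw [Submodule.pow_zero, Ideal.one_eq_top]; trivial
    | succ k ih =>
      intro x hx
      rw [pow_succ] at hx
      rw [Submodule.pow_succ]
      induction hx using Submodule.mul_induction_on' with
      | mem_mul_mem y hy z hz => rw [map_mul]; exact Ideal.mul_mem_mul (ih y hy) (hJ z hz)
      | add y _ z _ h1 h2 => rw [map_add]; exact add_mem h1 h2
  refine ⟨s, fun x hx => ?_⟩
  have := hpow s x hx
  rw [hs] at this
  exact Ideal.Quotient.eq_zero_iff_mem.1 this

/-- Levitzki's theorem: a multiplicatively closed set of nilpotent elements spans a nilpotent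
algebra. -/
theorem exists_span_pow_eq_bot {K M : Type*} [Field K] [IsAlgClosed K] [Ring M] [Algebra K M]
    [FiniteDimensional K M] (S : Set M) (hmul : ∀ x ∈ S, ∀ y ∈ S, x * y ∈ S)
    (hnil : ∀ x ∈ S, IsNilpotent x) : ∃ s : ℕ, Submodule.span K S ^ s = ⊥ := by
  let U := Algebra.adjoin K S
  let S' : Set U := Subtype.val ⁻¹' S
  obtain ⟨s, hs⟩ := exists_pow_le_of_killed (K := K) (⊥ : Ideal U) (Submodule.span K S') (by
    intro d π hd hπ _
    have hker : Submodule.span K S' ≤ LinearMap.ker π.toLinearMap := by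
      rw [Submodule.span_le]
      intro x hx
      change π x = 0
      -- The trace form is nondegenerate. As `u` is a combination of `1` and products of elements of
      -- `S'`, `u * x` is a combination of nilpotent elements of `S'`, so its image has trace zero.
      refine Matrix.ext_iff_trace_mul_left.2 fun y => ?_
      obtain ⟨u, rfl⟩ := hπ y
      rw [mul_zero, Matrix.trace_zero, ← map_mul]
      have hu : u ∈ Submodule.span K (Submonoid.closure S' : Set U) := by
        rw [← Algebra.adjoin_eq_span, Algebra.adjoin_adjoin_coe_preimage]; trivial
      induction hu using Submodule.span_induction with
      | mem u hu =>
        have hux : u * x ∈ S' := by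
          induction hu using Submonoid.closure_induction_left with
          | one => rwa [one_mul]
          | mul_left z hz w _ ih => rw [mul_assoc]; exact hmul _ hz _ ih
        have hn : IsNilpotent (u * x) := by
          obtain ⟨k, hk⟩ := hnil _ hux
          exact ⟨k, Subtype.ext hk⟩
        exact (Matrix.isNilpotent_trace_of_isNilpotent (hn.map π)).eq_zero
      | zero => simp
      | add u w _ _ h1 h2 => rw [add_mul, map_add, Matrix.trace_add, h1, h2, add_zero]
      | smul c u _ h => rw [smul_mul_assoc, map_smul, Matrix.trace_smul, h, smul_zero]
    exact fun x hx => hker hx)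
  refine ⟨s, ?_⟩
  have hmap : Submodule.span K S = (Submodule.span K S').map U.val.toLinearMap := by
    rw [Submodule.map_span]
    congr 1
    ext x
    constructor
    · intro hx
      exact ⟨⟨x, Algebra.subset_adjoin hx⟩, hx, rfl⟩
    · rintro ⟨y, hy, rfl⟩
      exact hy
  rw [hmap, ← Submodule.map_pow]
  rw [eq_bot_iff]
  rintro _ ⟨x, hx, rfl⟩
  have : x = 0 := hs hx
  simp [this]

end Radical

/-! ### Zariski closures of ideals of `A`. -/

section Ideals

variable {F K : Type*} [Field F] [Field K] [Algebra F K] {n : ℕ}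
  {A : Subalgebra F (Matrix (Fin n) (Fin n) K)} {N : Submodule F (Matrix (Fin n) (Fin n) K)}

/-- Take closures in one argument at a time: translation by a fixed `s ∈ N` maps the closure to
itself, hence so does translation by a fixed element of the closure. The same device gives products
in `closure_mul_mem`. -/
theorem closure_add_mem {x y : Matrix (Fin n) (Fin n) K}
    (hx : x ∈ zariskiClosure (N : Set (Matrix (Fin n) (Fin n) K)))
    (hy : y ∈ zariskiClosure (N : Set (Matrix (Fin n) (Fin n) K))) :
    x + y ∈ zariskiClosure (N : Set (Matrix (Fin n) (Fin n) K)) :=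
  ((IsPolyMap.const x).add IsPolyMap.id).mem_closure (fun s hs =>
    (IsPolyMap.id.add (IsPolyMap.const s)).mem_closure
      (fun _ ht => subset_zariskiClosure _ (N.add_mem ht hs)) hx) hy

theorem closure_mul_mem_left (h : ∀ a ∈ A, ∀ x ∈ N, a * x ∈ N) {a x : Matrix (Fin n) (Fin n) K}
    (ha : a ∈ A) (hx : x ∈ zariskiClosure (N : Set (Matrix (Fin n) (Fin n) K))) :
    a * x ∈ zariskiClosure (N : Set (Matrix (Fin n) (Fin n) K)) :=
  ((IsPolyMap.const a).mul IsPolyMap.id).mem_closure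
    (fun _ ht => subset_zariskiClosure _ (h a ha _ ht)) hx

theorem closure_mul_mem_right (h : ∀ a ∈ A, ∀ x ∈ N, x * a ∈ N) {a x : Matrix (Fin n) (Fin n) K}
    (ha : a ∈ A) (hx : x ∈ zariskiClosure (N : Set (Matrix (Fin n) (Fin n) K))) :
    x * a ∈ zariskiClosure (N : Set (Matrix (Fin n) (Fin n) K)) :=
  (IsPolyMap.id.mul (IsPolyMap.const a)).mem_closure
    (fun _ ht => subset_zariskiClosure _ (h a ha _ ht)) hx

theorem closure_mul_mem (hNA : N ≤ Subalgebra.toSubmodule A) (h : ∀ a ∈ A, ∀ x ∈ N, a * x ∈ N)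
    {x y : Matrix (Fin n) (Fin n) K}
    (hx : x ∈ zariskiClosure (N : Set (Matrix (Fin n) (Fin n) K)))
    (hy : y ∈ zariskiClosure (N : Set (Matrix (Fin n) (Fin n) K))) :
    x * y ∈ zariskiClosure (N : Set (Matrix (Fin n) (Fin n) K)) :=
  ((IsPolyMap.const x).mul IsPolyMap.id).mem_closure (fun s hs =>
    (IsPolyMap.id.mul (IsPolyMap.const s)).mem_closure
      (fun _ ht => subset_zariskiClosure _ (h _ (hNA ht) _ hs)) hx) hy

theorem closure_sub_mem {x y : Matrix (Fin n) (Fin n) K}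
    (hx : x ∈ zariskiClosure (N : Set (Matrix (Fin n) (Fin n) K)))
    (hy : y ∈ zariskiClosure (N : Set (Matrix (Fin n) (Fin n) K))) :
    x - y ∈ zariskiClosure (N : Set (Matrix (Fin n) (Fin n) K)) := by
  have : (-1) * y ∈ zariskiClosure (N : Set (Matrix (Fin n) (Fin n) K)) :=
    ((IsPolyMap.const (-1)).mul IsPolyMap.id).mem_closure
      (fun _ ht => subset_zariskiClosure _ (by simpa using N.neg_mem ht)) hy
  rw [neg_one_mul] at this
  rw [sub_eq_add_neg]
  exact closure_add_mem hx this

/-- The Zariski closure of an ideal contains an idempotent whose complementary corner of the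
closure is nil. -/
theorem exists_maximal_idempotent (hNA : N ≤ Subalgebra.toSubmodule A)
    (hl : ∀ a ∈ A, ∀ x ∈ N, a * x ∈ N) :
    ∃ e ∈ zariskiClosure (N : Set (Matrix (Fin n) (Fin n) K)),
      ∀ x ∈ zariskiClosure (N : Set (Matrix (Fin n) (Fin n) K)),
        IsNilpotent ((1 - e) * x * (1 - e)) := by
  let fix : Matrix (Fin n) (Fin n) K → Submodule K (Matrix (Fin n) (Fin n) K) :=
    fun e => LinearMap.ker (LinearMap.mulLeft K e - LinearMap.id)
  have hfix : ∀ e y, y ∈ fix e ↔ e * y = y := by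
    intro e y
    simp [fix, sub_eq_zero]
  -- Choose an idempotent of the closure with maximal fixed space. If the complementary corner were
  -- not nil, a nonzero idempotent `ε` orthogonal to `e` would arise there, and `e + ε` would have a
  -- larger fixed space.
  obtain ⟨e, ⟨heN, hee⟩, hmax⟩ := (InvImage.wf fix wellFounded_gt).has_min
    {e | e ∈ zariskiClosure (N : Set (Matrix (Fin n) (Fin n) K)) ∧ e * e = e}
    ⟨0, subset_zariskiClosure _ N.zero_mem, by simp⟩
  refine ⟨e, heN, fun x hx => ?_⟩
  by_contra hnil
  have he1 : e * (1 - e) = 0 := by rw [mul_sub, mul_one, hee, sub_self]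
  have he2 : (1 - e) * e = 0 := by rw [sub_mul, one_mul, hee, sub_self]
  set a := (1 - e) * x * (1 - e) with ha
  have haN : a ∈ zariskiClosure (N : Set (Matrix (Fin n) (Fin n) K)) := by
    have : a = (x - e * x) - (x * e - e * x * e) := by rw [ha]; noncomm_ring
    rw [this]
    have h1 := closure_mul_mem hNA hl heN hx
    exact closure_sub_mem (closure_sub_mem hx h1) (closure_sub_mem
      (closure_mul_mem hNA hl hx heN) (closure_mul_mem hNA hl h1 heN))
  obtain ⟨ε, hε, hε0, hεε⟩ := exists_idempotent_mem_closure hnil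
  have hεN : ε ∈ zariskiClosure (N : Set (Matrix (Fin n) (Fin n) K)) := by
    refine zariskiClosure_subset ?_ hε
    rintro _ ⟨k, rfl⟩
    induction k with
    | zero => simpa using haN
    | succ k ih => rw [pow_succ]; exact closure_mul_mem hNA hl ih haN
  -- Orthogonality to `e` holds for every positive power of `a` and is a polynomial condition, so it
  -- passes to the closure.
  have h1 : e * ε = 0 := by
    refine ((IsPolyMap.const e).mul IsPolyMap.id).eq_zero ?_ hε
    rintro _ ⟨k, rfl⟩
    rw [pow_succ', ← mul_assoc, ha, ← mul_assoc, ← mul_assoc, he1]; simp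
  have h2 : ε * e = 0 := by
    refine (IsPolyMap.id.mul (IsPolyMap.const e)).eq_zero ?_ hε
    rintro _ ⟨k, rfl⟩
    rw [pow_succ, mul_assoc, ha, mul_assoc _ (1 - e) e, he2]; simp
  refine hmax (e + ε) ⟨closure_add_mem heN hεN, ?_⟩ ?_
  · rw [add_mul, mul_add, mul_add, hee, h1, h2, hεε]; simp
  · refine lt_of_le_of_ne (fun y hy => ?_) fun h => hε0 ?_
    · rw [hfix] at hy ⊢
      rw [add_mul, hy, ← hy, ← mul_assoc, h2]; simp
    · have : ε ∈ fix e := by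
        rw [h, hfix, add_mul, h1, hεε, zero_add]
      rw [hfix, h1] at this
      exact this.symm

/-- Modulo the closure, `q ∈ A` equals `(1 - e) * q * (1 - e)`, since the difference is built from
products with `e`. For `q ∈ Q` these corner parts lie in the span of `S`, which is nilpotent by
Levitzki's theorem. -/
theorem exists_pow_le_closure [IsAlgClosed K] (hNA : N ≤ Subalgebra.toSubmodule A)
    (hl : ∀ a ∈ A, ∀ x ∈ N, a * x ∈ N) (hr : ∀ a ∈ A, ∀ x ∈ N, x * a ∈ N)
    (Q : Submodule F (Matrix (Fin n) (Fin n) K)) (hQA : Q ≤ Subalgebra.toSubmodule A)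
    (hQN : ∀ x ∈ Q, x ∈ Submodule.span K (N : Set (Matrix (Fin n) (Fin n) K))) :
    ∃ s : ℕ, ∀ x ∈ Q ^ s, x ∈ zariskiClosure (N : Set (Matrix (Fin n) (Fin n) K)) := by
  obtain ⟨e, heN, hnil⟩ := exists_maximal_idempotent hNA hl
  let S : Set (Matrix (Fin n) (Fin n) K) := {y | ∃ x ∈ zariskiClosure
    (N : Set (Matrix (Fin n) (Fin n) K)), y = (1 - e) * x * (1 - e)}
  obtain ⟨s, hs⟩ := exists_span_pow_eq_bot (K := K) S (by
    rintro _ ⟨x, hx, rfl⟩ _ ⟨y, hy, rfl⟩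
    refine ⟨x * (1 - e) * (1 - e) * y, ?_, by simp only [mul_assoc]⟩
    have : x * (1 - e) * (1 - e) * y = (x * y - x * e * y) - (x * e * y - x * e * e * y) := by
      noncomm_ring
    rw [this]
    have h1 := closure_mul_mem hNA hl hx heN
    have h2 := closure_mul_mem hNA hl h1 hy
    exact closure_sub_mem (closure_sub_mem (closure_mul_mem hNA hl hx hy) h2)
      (closure_sub_mem h2 (closure_mul_mem hNA hl (closure_mul_mem hNA hl h1 heN) hy))) (by
    rintro _ ⟨x, hx, rfl⟩
    exact hnil x hx)
  have hspan : ∀ q ∈ Submodule.span K (N : Set (Matrix (Fin n) (Fin n) K)),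
      (1 - e) * q * (1 - e) ∈ Submodule.span K S := by
    intro q hq
    induction hq using Submodule.span_induction with
    | mem x hx => exact Submodule.subset_span ⟨x, subset_zariskiClosure _ hx, rfl⟩
    | zero => simp
    | add x y _ _ hx hy => rw [mul_add, add_mul]; exact add_mem hx hy
    | smul c x _ hx => rw [mul_smul_comm, smul_mul_assoc]; exact Submodule.smul_mem _ _ hx
  have key : ∀ k : ℕ, ∀ p ∈ Q ^ k, p ∈ A ∧ ∃ p' ∈ Submodule.span K S ^ k,
      p - p' ∈ zariskiClosure (N : Set (Matrix (Fin n) (Fin n) K)) := by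
    intro k
    induction k with
    | zero =>
      intro p hp
      rw [pow_zero, Submodule.mem_one] at hp
      obtain ⟨r, rfl⟩ := hp
      refine ⟨A.algebraMap_mem r, algebraMap F _ r, ?_, ?_⟩
      · rw [pow_zero, Submodule.mem_one]
        exact ⟨algebraMap F K r, (IsScalarTower.algebraMap_apply F K _ r).symm⟩
      · rw [sub_self]; exact subset_zariskiClosure _ N.zero_mem
    | succ k ih =>
      intro p hp
      rw [pow_succ'] at hp
      induction hp using Submodule.mul_induction_on' with
      | mem_mul_mem q hq p hp =>
        obtain ⟨hpA, p', hp', hpp⟩ := ih p hp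
        refine ⟨A.mul_mem (hQA hq) hpA, (1 - e) * q * (1 - e) * p', ?_, ?_⟩
        · rw [pow_succ']
          exact Submodule.mul_mem_mul (hspan q (hQN q hq)) hp'
        · have h1 : q - (1 - e) * q * (1 - e) ∈
              zariskiClosure (N : Set (Matrix (Fin n) (Fin n) K)) := by
            have : q - (1 - e) * q * (1 - e) = e * q + (q * e - e * (q * e)) := by noncomm_ring
            rw [this]
            have h2 := closure_mul_mem_left hl (hQA hq) heN
            exact closure_add_mem (closure_mul_mem_right hr (hQA hq) heN)
              (closure_sub_mem h2 (closure_mul_mem hNA hl heN h2))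
          -- Corner parts such as `p'` need not lie in `A`, so the difference is rewritten to
          -- involve only products of closure elements with elements of `A` or of the closure.
          have : q * p - (1 - e) * q * (1 - e) * p' =
              (q - (1 - e) * q * (1 - e)) * p + (q * (p - p') -
                (q - (1 - e) * q * (1 - e)) * (p - p')) := by noncomm_ring
          rw [this]
          exact closure_add_mem (closure_mul_mem_right hr hpA h1) (closure_sub_mem
            (closure_mul_mem_left hl (hQA hq) hpp) (closure_mul_mem hNA hl h1 hpp))
      | add x _ y _ hx hy =>
        obtain ⟨hxA, x', hx', hxx⟩ := hx
        obtain ⟨hyA, y', hy', hyy⟩ := hy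
        refine ⟨A.add_mem hxA hyA, x' + y', add_mem hx' hy', ?_⟩
        rw [add_sub_add_comm]
        exact closure_add_mem hxx hyy
  refine ⟨s, fun x hx => ?_⟩
  obtain ⟨-, x', hx', h⟩ := key s x hx
  rw [hs, Submodule.mem_bot] at hx'
  rwa [hx', sub_zero] at h

theorem mem_adjoin_iff_mem_span (A : Subalgebra F (Matrix (Fin n) (Fin n) K))
    (x : Matrix (Fin n) (Fin n) K) :
    x ∈ Algebra.adjoin K (A : Set (Matrix (Fin n) (Fin n) K)) ↔
      x ∈ Submodule.span K (A : Set (Matrix (Fin n) (Fin n) K)) := by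
  have h : Submonoid.closure (A : Set (Matrix (Fin n) (Fin n) K)) = A.toSubmonoid :=
    Submonoid.closure_eq A.toSubmonoid
  rw [← Subalgebra.mem_toSubmodule, Algebra.adjoin_eq_span, h]; rfl

/-- Products of sufficiently many elements of `A` that are killed by every irreducible
representation of `A` killing the ideal `N` lie in the Zariski closure of `N`. -/
theorem exists_pow_killed_le_closure [IsAlgClosed K] (hNA : N ≤ Subalgebra.toSubmodule A)
    (hl : ∀ a ∈ A, ∀ x ∈ N, a * x ∈ N) (hr : ∀ a ∈ A, ∀ x ∈ N, x * a ∈ N)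
    (P : Submodule F (Matrix (Fin n) (Fin n) K)) (hPA : P ≤ Subalgebra.toSubmodule A)
    (hP : ∀ (d : ℕ) (π : Algebra.adjoin K (A : Set (Matrix (Fin n) (Fin n) K)) →ₐ[K]
      Matrix (Fin d) (Fin d) K), 0 < d → Function.Surjective π →
      (∀ x, x.1 ∈ N → π x = 0) → ∀ x, x.1 ∈ P → π x = 0) :
    ∃ s : ℕ, ∀ x ∈ P ^ s, x ∈ zariskiClosure (N : Set (Matrix (Fin n) (Fin n) K)) := by
  let B := Algebra.adjoin K (A : Set (Matrix (Fin n) (Fin n) K))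
  have hKl : ∀ x : B, ∀ y ∈ Submodule.span K (N : Set (Matrix (Fin n) (Fin n) K)),
      x.1 * y ∈ Submodule.span K (N : Set (Matrix (Fin n) (Fin n) K)) := by
    intro x y hy
    have := Submodule.mul_mem_mul ((mem_adjoin_iff_mem_span A x.1).1 x.2) hy
    rw [Submodule.span_mul_span] at this
    refine Submodule.span_mono ?_ this
    rintro _ ⟨a, ha, z, hz, rfl⟩
    exact hl a ha z hz
  have hKr : ∀ x : B, ∀ y ∈ Submodule.span K (N : Set (Matrix (Fin n) (Fin n) K)),
      y * x.1 ∈ Submodule.span K (N : Set (Matrix (Fin n) (Fin n) K)) := by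
    intro x y hy
    have := Submodule.mul_mem_mul hy ((mem_adjoin_iff_mem_span A x.1).1 x.2)
    rw [Submodule.span_mul_span] at this
    refine Submodule.span_mono ?_ this
    rintro _ ⟨z, hz, a, ha, rfl⟩
    exact hr a ha z hz
  let I : Ideal B :=
    { carrier := {x | x.1 ∈ Submodule.span K (N : Set (Matrix (Fin n) (Fin n) K))}
      add_mem' := fun hx hy =>
        (Submodule.span K (N : Set (Matrix (Fin n) (Fin n) K))).add_mem hx hy
      zero_mem' := zero_mem (Submodule.span K (N : Set (Matrix (Fin n) (Fin n) K)))
      smul_mem' := fun c x hx => hKl c x.1 hx }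
  have : I.IsTwoSided := ⟨fun {a} b ha => hKr b a.1 ha⟩
  obtain ⟨s, hs⟩ := exists_pow_le_of_killed I (Submodule.span K {x : B | x.1 ∈ P}) (by
    intro d π hd hπ hI
    have hle : Submodule.span K {x : B | x.1 ∈ P} ≤ LinearMap.ker π.toLinearMap := by
      rw [Submodule.span_le]
      intro x hx
      exact hP d π hd hπ (fun y hy => hI y (Submodule.subset_span hy)) x hx
    exact fun x hx => hle hx)
  have key : ∀ k : ℕ, ∀ p ∈ P ^ k, p ∈ A ∧
      ∃ b ∈ Submodule.span K {x : B | x.1 ∈ P} ^ k, b.1 = p := by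
    intro k
    induction k with
    | zero =>
      intro p hp
      rw [pow_zero, Submodule.mem_one] at hp
      obtain ⟨r, rfl⟩ := hp
      refine ⟨A.algebraMap_mem r, algebraMap K B (algebraMap F K r), ?_, ?_⟩
      · rw [pow_zero, Submodule.mem_one]
        exact ⟨_, rfl⟩
      · exact (IsScalarTower.algebraMap_apply F K _ r).symm
    | succ k ih =>
      intro p hp
      rw [pow_succ'] at hp
      induction hp using Submodule.mul_induction_on' with
      | mem_mul_mem q hq p hp =>
        obtain ⟨hpA, b, hb, rfl⟩ := ih p hp
        refine ⟨A.mul_mem (hPA hq) hpA, ⟨q, Algebra.subset_adjoin (hPA hq)⟩ * b, ?_, rfl⟩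
        rw [pow_succ']
        exact Submodule.mul_mem_mul (Submodule.subset_span hq) hb
      | add x _ y _ hx hy =>
        obtain ⟨hxA, b, hb, rfl⟩ := hx
        obtain ⟨hyA, c, hc, rfl⟩ := hy
        exact ⟨A.add_mem hxA hyA, b + c, add_mem hb hc, rfl⟩
  -- `P ^ s` lies in the `K`-span of `N`; a further power `t` brings it into the closure.
  obtain ⟨t, ht⟩ := exists_pow_le_closure hNA hl hr (P ^ s) (fun p hp => (key s p hp).1) (by
    intro p hp
    obtain ⟨-, b, hb, rfl⟩ := key s p hp
    exact hs hb)
  exact ⟨s * t, fun x hx => ht x (by rwa [← pow_mul])⟩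

end Ideals

/-! ### Evaluation of noncommutative polynomials. -/

section Eval

variable {F A B : Type*} [Field F] [Ring A] [Algebra F A] [Ring B] [Algebra F B]

@[simp] theorem eval_X (v : ℕ → A) (j : ℕ) : eval v (X F j) = v j := by
  simp [eval]

@[simp] theorem eval_mul (v : ℕ → A) (f g : NCPoly F) : eval v (f * g) = eval v f * eval v g :=
  map_mul _ f g

@[simp] theorem eval_sub (v : ℕ → A) (f g : NCPoly F) : eval v (f - g) = eval v f - eval v g :=
  map_sub _ f g

theorem map_eval (φ : A →ₐ[F] B) (v : ℕ → A) (f : NCPoly F) :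
    φ (eval v f) = eval (fun j => φ (v j)) f := by
  have : φ.comp (FreeAlgebra.lift F v) = FreeAlgebra.lift F fun j => φ (v j) := by
    ext j; simp
  exact congrArg (fun ψ => ψ f) this

theorem eval_lift (v : ℕ → A) (φ : ℕ → NCPoly F) (f : NCPoly F) :
    eval v (FreeAlgebra.lift F φ f) = eval (fun j => eval v (φ j)) f :=
  map_eval (FreeAlgebra.lift F v) φ f

theorem eval_subst (v : ℕ → A) (i : ℕ) (u f : NCPoly F) :
    eval v (subst i u f) = eval (Function.update v i (eval v u)) f := by
  rw [subst, eval_lift]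
  congr 1
  funext j
  by_cases h : j = i
  · subst h; simp
  · simp [Function.update_of_ne h]

theorem eval_congr {T : Set ℕ} {f : NCPoly F} (hf : f ∈ Algebra.adjoin F (X F '' T))
    {v v' : ℕ → A} (h : ∀ j ∈ T, v j = v' j) : eval v f = eval v' f := by
  induction hf using Algebra.adjoin_induction with
  | mem x hx => obtain ⟨j, hj, rfl⟩ := hx; simpa using h j hj
  | algebraMap r => simp [eval]
  | add x y _ _ hx hy => simp only [eval, map_add] at *; rw [hx, hy]
  | mul x y _ _ hx hy => rw [eval_mul, eval_mul, hx, hy]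

theorem exists_mem_adjoin_Iio (f : NCPoly F) :
    ∃ M : ℕ, f ∈ Algebra.adjoin F (X F '' Set.Iio M) := by
  have mono : ∀ {M M' : ℕ} {g : NCPoly F}, M ≤ M' → g ∈ Algebra.adjoin F (X F '' Set.Iio M) →
      g ∈ Algebra.adjoin F (X F '' Set.Iio M') := fun h hg =>
    Algebra.adjoin_mono (Set.image_mono (Set.Iio_subset_Iio h)) hg
  induction f using FreeAlgebra.induction with
  | grade0 r => exact ⟨0, Subalgebra.algebraMap_mem _ r⟩
  | grade1 j => exact ⟨j + 1, Algebra.subset_adjoin ⟨j, by simp, rfl⟩⟩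
  | mul a b ha hb =>
    obtain ⟨M, hM⟩ := ha
    obtain ⟨M', hM'⟩ := hb
    exact ⟨max M M', Subalgebra.mul_mem _ (mono (le_max_left _ _) hM)
      (mono (le_max_right _ _) hM')⟩
  | add a b ha hb =>
    obtain ⟨M, hM⟩ := ha
    obtain ⟨M', hM'⟩ := hb
    exact ⟨max M M', Subalgebra.add_mem _ (mono (le_max_left _ _) hM)
      (mono (le_max_right _ _) hM')⟩

theorem avoids_of_mem_adjoin_Iio {M j : ℕ} {f : NCPoly F}
    (hf : f ∈ Algebra.adjoin F (X F '' Set.Iio M)) (hj : M ≤ j) : Avoids j f := by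
  refine Algebra.adjoin_mono (Set.image_mono fun t ht => ?_) hf
  simp only [Set.mem_Iio, Set.mem_compl_iff, Set.mem_singleton_iff] at *
  omega

theorem eval_update_of_avoids {i : ℕ} {f : NCPoly F} (hf : Avoids i f) (v : ℕ → A) (a : A) :
    eval (Function.update v i a) f = eval v f :=
  eval_congr hf fun _ hj => Function.update_of_ne hj _ _

theorem eval_capelliPoly {d : ℕ} (v : ℕ → A) (y w : Fin d → ℕ) :
    eval v (capelliPoly F y w) = capelli (fun j => v (y j)) (fun j => v (w j)) := by
  rw [eval, capelliPoly, map_capelli]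
  simp

theorem eval_coeffPoly (v : ℕ → A) (Y : Finset ℕ) (k c : ℕ) (f : NCPoly F) :
    eval v (coeffPoly Y k (X F c) f) = alphaPol Y 1 k (v c) (fun v => eval v f) v := by
  have : eval v (coeffPoly Y k (X F c) f) = ∑ S ∈ Y.powersetCard k,
      eval v (FreeAlgebra.lift F (fun j => if j ∈ S then X F c * X F j else X F j) f) :=
    map_sum _ _ _
  rw [this]
  refine Finset.sum_congr rfl fun S _ => ?_
  rw [eval_lift]
  congr 1
  funext j
  split_ifs <;> simp

end Eval

/-! ### Coefficient operators with the other indeterminates fixed. -/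

section Fiber

variable {F A : Type*} [Field F] [Ring A] [Algebra F A] {N : ℕ}

/-- A substitution splits into the values `Y` of the alternating indeterminates and a background
`v`. The operator changes only `Y`, and the exponent `q` is absorbed into the element `a ^ q`. -/
theorem alphaPol_extend {y : Fin N → ℕ} (hy : Function.Injective y) (q k : ℕ) (a : A)
    (Φ : (ℕ → A) → A) (v : ℕ → A) (Y : Fin N → A) :
    alphaPol (idx y) q k a Φ (Function.extend y Y v) =
      coeffOp k (a ^ q) (fun Y => Φ (Function.extend y Y v)) Y := by
  have hidx : idx y = Finset.univ.map ⟨y, hy⟩ := by rw [idx, Finset.map_eq_image]; rfl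
  rw [alphaPol, coeffOp, hidx, Finset.powersetCard_map, Finset.sum_map]
  refine Finset.sum_congr rfl fun S _ => ?_
  congr 1
  funext j
  by_cases h : ∃ t, y t = j
  · obtain ⟨t, rfl⟩ := h
    simp [hy.extend_apply]
  · rw [Function.extend_apply' _ _ _ h, Function.extend_apply' _ _ _ h, if_neg]
    intro hj
    obtain ⟨t, -, rfl⟩ := Finset.mem_map.1 hj
    exact h ⟨t, rfl⟩

theorem extend_self {A : Type*} {y : Fin N → ℕ} (hy : Function.Injective y) (v : ℕ → A) :
    Function.extend y (fun j => v (y j)) v = v := by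
  funext j
  by_cases h : ∃ t, y t = j
  · obtain ⟨t, rfl⟩ := h
    rw [hy.extend_apply]
  · rw [Function.extend_apply' _ _ _ h]

/-- Successive coefficient operations on functions of `N` arguments. -/
def coeffOps (L : List (A × ℕ)) (Ψ : (Fin N → A) → A) : (Fin N → A) → A :=
  L.foldr (fun s Ψ => coeffOp s.2 s.1 Ψ) Ψ

theorem eval_extend_coeffPoly {y : Fin N → ℕ} (hy : Function.Injective y) (k : ℕ) {c : ℕ}
    (hc : ∀ t, y t ≠ c) (f : NCPoly F) (v : ℕ → A) :
    (fun Y => eval (Function.extend y Y v) (coeffPoly (idx y) k (X F c) f)) =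
      coeffOp k (v c) (fun Y => eval (Function.extend y Y v) f) := by
  funext Y
  rw [eval_coeffPoly, alphaPol_extend hy, pow_one, Function.extend_apply' _ _ _ (by simpa using hc)]

theorem eval_extend_capelliPoly {y w : Fin N → ℕ} (hy : Function.Injective y)
    (hw : ∀ t s, y t ≠ w s) (v : ℕ → A) :
    (fun Y => eval (Function.extend y Y v) (capelliPoly F y w)) =
      fun Y => capelli Y fun j => v (w j) := by
  funext Y
  rw [eval_capelliPoly]
  congr 1
  · funext j; rw [hy.extend_apply]
  · funext j; rw [Function.extend_apply' _ _ _ fun ⟨t, ht⟩ => hw t j ht]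

theorem eval_extend_coeffWord {y w : Fin N → ℕ} (hy : Function.Injective y)
    (hw : ∀ t s, y t ≠ w s) (L : List (ℕ × ℕ)) (hL : ∀ s ∈ L, ∀ t, y t ≠ s.1) (v : ℕ → A) :
    (fun Y => eval (Function.extend y Y v) (coeffWord (idx y) L (capelliPoly F y w))) =
      coeffOps (L.map fun s => (v s.1, s.2)) fun Y => capelli Y fun j => v (w j) := by
  induction L with
  | nil => exact eval_extend_capelliPoly hy hw v
  | cons s L ih =>
    have := eval_extend_coeffPoly (F := F) hy s.2 (hL s (by simp))
      (coeffWord (idx y) L (capelliPoly F y w)) v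
    rw [ih fun t ht => hL t (List.mem_cons_of_mem _ ht)] at this
    exact this

end Fiber

/-! ### Values of the commutators. -/

section CommutatorValues

variable {F A : Type*} [Field F] [Ring A] [Algebra F A]

/-- The values of the commutators of two coefficient operations. -/
def operatorCommutator {N : ℕ} (k l : ℕ) (a b : A) (L : List (A × ℕ)) (Y W : Fin N → A) : A :=
  coeffOp k a (coeffOp l b (coeffOps L fun Y => capelli Y W)) Y -
    coeffOp l b (coeffOp k a (coeffOps L fun Y => capelli Y W)) Y

/-- The values of the commutators of Capelli-bonded expressions. -/
def bondCommutator {N : ℕ} (k : ℕ) (a v : A) (Y W W' : Fin N → A) : A :=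
  capelli Y W * v * capelli Y W' *
      (coeffOp k a (fun Y => capelli Y W) Y * v * coeffOp k a (fun Y => capelli Y W') Y) -
    coeffOp k a (fun Y => capelli Y W) Y * v * coeffOp k a (fun Y => capelli Y W') Y *
      (capelli Y W * v * capelli Y W')

/-- `c` is a value in `A` of a commutator of matrix degree `m`. -/
def IsCommutatorValue (m : ℕ) (c : A) : Prop :=
  (∃ (k l : ℕ) (a b : A) (L : List (A × ℕ)) (Y W : Fin (m ^ 2) → A),
    c = operatorCommutator k l a b L Y W) ∨
  ∃ (k : ℕ) (a v : A) (Y W W' : Fin (m ^ 2) → A), c = bondCommutator k a v Y W W'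

theorem isCommutatorValue_eval {m : ℕ} {l : List ℕ} {C : NCPoly F} (hl : l.Nodup)
    (hC : IsOperatorCommutator m l C ∨ IsBondCommutator m l C) (v : ℕ → A) :
    IsCommutatorValue m (eval v C) := by
  rcases hC with ⟨y, w, a, b, k, k', L, rfl, rfl⟩ | ⟨y, w, w', a, c, k, E, E', rfl, rfl, rfl, rfl⟩
  · simp only [List.nodup_cons, List.nodup_append, List.nodup_ofFn, List.mem_cons,
      List.mem_append, List.mem_ofFn', not_or] at hl
    obtain ⟨⟨-, ⟨hay, -⟩, -⟩, ⟨⟨hby, -⟩, -⟩, ⟨hy, -, hyw⟩, -, hL⟩ := hl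
    have hyw' : ∀ t s, y t ≠ w s := fun t s => hyw _ ⟨t, rfl⟩ _ ⟨s, rfl⟩
    have hL' : ∀ s ∈ L, ∀ t, y t ≠ s.1 := fun s hs t =>
      hL _ (Or.inl ⟨t, rfl⟩) _ (List.mem_map_of_mem hs)
    have ha : ∀ t, y t ≠ a := fun t ht => hay ⟨t, ht⟩
    have hb : ∀ t, y t ≠ b := fun t ht => hby ⟨t, ht⟩
    refine Or.inl ⟨k, k', v a, v b, L.map fun s => (v s.1, s.2), fun j => v (y j),
      fun j => v (w j), ?_⟩
    rw [operatorCommutator, ← eval_extend_coeffWord (F := F) hy hyw' L hL' v,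
      ← eval_extend_coeffPoly hy k' hb, ← eval_extend_coeffPoly hy k ha,
      ← eval_extend_coeffPoly hy k ha, ← eval_extend_coeffPoly hy k' hb]
    simp only [extend_self hy, eval_sub]
  · simp only [List.nodup_cons, List.nodup_append, List.nodup_ofFn, List.mem_cons,
      List.mem_append, List.mem_ofFn', not_or] at hl
    obtain ⟨⟨-, ⟨hay, -⟩, -⟩, -, ⟨hy, -, hyw⟩, -, hL⟩ := hl
    have hyw₁ : ∀ t s, y t ≠ w s := fun t s => hyw _ ⟨t, rfl⟩ _ ⟨s, rfl⟩
    have hyw₂ : ∀ t s, y t ≠ w' s := fun t s => hL _ (Or.inl ⟨t, rfl⟩) _ ⟨s, rfl⟩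
    have ha : ∀ t, y t ≠ a := fun t ht => hay ⟨t, ht⟩
    refine Or.inr ⟨k, v a, v c, fun j => v (y j), fun j => v (w j), fun j => v (w' j), ?_⟩
    rw [bondCommutator, ← eval_extend_capelliPoly (F := F) hy hyw₁ v,
      ← eval_extend_capelliPoly (F := F) hy hyw₂ v,
      ← eval_extend_coeffPoly hy k ha, ← eval_extend_coeffPoly hy k ha]
    simp only [extend_self hy, eval_sub, eval_mul, eval_capelliPoly, eval_X]

/-- Each entry receives its own index from `M` on, even if elements repeat, since the indeterminates
of a commutator must be distinct. -/
theorem exists_list_values {A : Type*} (L : List (A × ℕ)) (M : ℕ) (u₀ : ℕ → A) :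
    ∃ (L' : List (ℕ × ℕ)) (u : ℕ → A), (L'.map Prod.fst).Nodup ∧ (∀ s ∈ L', M ≤ s.1) ∧
      L'.map (fun s => (u s.1, s.2)) = L ∧ ∀ j < M, u j = u₀ j := by
  induction L generalizing M u₀ with
  | nil => exact ⟨[], u₀, by simp, by simp, rfl, fun _ _ => rfl⟩
  | cons x L ih =>
    obtain ⟨L', u, h1, h2, h3, h4⟩ := ih (M + 1) (Function.update u₀ M x.1)
    refine ⟨(M, x.2) :: L', u, ?_, ?_, ?_, fun j hj => ?_⟩
    · rw [List.map_cons, List.nodup_cons]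
      refine ⟨fun h => ?_, h1⟩
      obtain ⟨s, hs, hsM⟩ := List.mem_map.1 h
      have := h2 s hs
      omega
    · intro s hs
      rcases List.mem_cons.1 hs with rfl | hs
      · rfl
      · exact (Nat.le_succ M).trans (h2 s hs)
    · rw [List.map_cons, h3, h4 M (Nat.lt_succ_self M), Function.update_self]
    · rw [h4 j (by omega), Function.update_of_ne (by omega)]

/-- Converse of `isCommutatorValue_eval`: with distinct indices from `M` on, all the arguments can
be prescribed freely without disturbing the values `u₀` below `M`. -/
theorem exists_eval_eq_of_isCommutatorValue {m : ℕ} {c : A} (hc : IsCommutatorValue m c) (M : ℕ)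
    (u₀ : ℕ → A) :
    ∃ (l : List ℕ) (C : NCPoly F) (u : ℕ → A), l.Nodup ∧ (∀ j ∈ l, M ≤ j) ∧
      (IsOperatorCommutator m l C ∨ IsBondCommutator m l C) ∧ (∀ j < M, u j = u₀ j) ∧
      eval u C = c := by
  set N := m ^ 2 with hN
  let y : Fin N → ℕ := fun j => M + 2 + j
  let w : Fin N → ℕ := fun j => M + 2 + N + j
  let w' : Fin N → ℕ := fun j => M + 2 + 2 * N + j
  have hy : Function.Injective y := fun s t h => Fin.ext (by simpa [y] using h)
  have hw : Function.Injective w := fun s t h => Fin.ext (by simpa [w] using h)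
  have hw' : Function.Injective w' := fun s t h => Fin.ext (by simpa [w'] using h)
  have hyw : ∀ t s, y t ≠ w s := fun t s => by simp only [y, w]; omega
  have hyw' : ∀ t s, y t ≠ w' s := fun t s => by simp only [y, w']; omega
  have hww' : ∀ t s, w t ≠ w' s := fun t s => by simp only [w, w']; omega
  have hya : ∀ t, y t ≠ M := fun t => by simp only [y]; omega
  have hyb : ∀ t, y t ≠ M + 1 := fun t => by simp only [y]; omega
  rcases hc with ⟨k, k', a, b, L, Y, W, rfl⟩ | ⟨k, a, b, Y, W, W', rfl⟩
  · let u₁ : ℕ → A := Function.extend y Y (Function.extend w W fun j =>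
      if j < M then u₀ j else if j = M then a else b)
    obtain ⟨L', u, h1, h2, h3, h4⟩ := exists_list_values L (M + 2 + 2 * N) u₁
    have huy : (fun j => u (y j)) = Y := by
      funext j
      rw [h4 _ (by simp only [y]; omega)]
      exact hy.extend_apply _ _ _
    have huw : (fun j => u (w j)) = W := by
      funext j
      rw [h4 _ (by simp only [w]; omega)]
      simp only [u₁]
      rw [Function.extend_apply' _ _ _ fun ⟨t, ht⟩ => hyw t j ht, hw.extend_apply]
    have hu : ∀ j < M + 2, u j = if j < M then u₀ j else if j = M then a else b := by
      intro j hj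
      rw [h4 _ (by omega)]
      simp only [u₁]
      rw [Function.extend_apply' _ _ _ fun ⟨t, ht⟩ => by simp only [y] at ht; omega,
        Function.extend_apply' _ _ _ fun ⟨t, ht⟩ => by simp only [w] at ht; omega]
    have hL' : ∀ s ∈ L', ∀ t, y t ≠ s.1 := fun s hs t => by
      have := h2 s hs
      simp only [y]; omega
    refine ⟨_, _, u, ?_, ?_, Or.inl ⟨y, w, M, M + 1, k, k', L', rfl, rfl⟩,
      fun j hj => ?_, ?_⟩
    · simp only [List.nodup_cons, List.nodup_append, List.nodup_ofFn, List.mem_cons,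
        List.mem_append, List.mem_ofFn', not_or, List.mem_map]
      refine ⟨⟨by omega, ⟨?_, ?_⟩, ?_⟩, ⟨⟨?_, ?_⟩, ?_⟩, ⟨hy, hw, ?_⟩, h1, ?_⟩
      · rintro ⟨t, ht⟩; simp only [y] at ht; omega
      · rintro ⟨t, ht⟩; simp only [w] at ht; omega
      · rintro ⟨s, hs, hs'⟩; have := h2 s hs; omega
      · rintro ⟨t, ht⟩; simp only [y] at ht; omega
      · rintro ⟨t, ht⟩; simp only [w] at ht; omega
      · rintro ⟨s, hs, hs'⟩; have := h2 s hs; omega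
      · rintro _ ⟨t, rfl⟩ _ ⟨s, rfl⟩; exact hyw t s
      · rintro _ (⟨t, rfl⟩ | ⟨t, rfl⟩) _ ⟨s, hs, rfl⟩
        · exact hL' s hs t
        · have := h2 s hs
          simp only [w]; omega
    · simp only [List.mem_cons, List.mem_append, List.mem_ofFn', List.mem_map]
      rintro j (rfl | rfl | (⟨t, rfl⟩ | ⟨t, rfl⟩) | ⟨s, hs, rfl⟩)
      · rfl
      · omega
      · simp only [y]; omega
      · simp only [w]; omega
      · have := h2 s hs
        omega
    · rw [hu j (by omega), if_pos hj]
    · rw [operatorCommutator, ← h3, ← huw, ← eval_extend_coeffWord (F := F) hy hyw L' hL' u]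
      have e1 := hu M (by omega)
      have e2 := hu (M + 1) (by omega)
      simp at e1 e2
      rw [← e1, ← e2]
      rw [← eval_extend_coeffPoly hy k' hyb, ← eval_extend_coeffPoly hy k hya,
        ← eval_extend_coeffPoly hy k hya, ← eval_extend_coeffPoly hy k' hyb]
      simp only [← huy, extend_self hy, eval_sub]
  · let u : ℕ → A := Function.extend y Y (Function.extend w W (Function.extend w' W' fun j =>
      if j < M then u₀ j else if j = M then a else b))
    have huy : (fun j => u (y j)) = Y := funext fun j => hy.extend_apply _ _ _
    have huw : (fun j => u (w j)) = W := by
      funext j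
      simp only [u]
      rw [Function.extend_apply' _ _ _ fun ⟨t, ht⟩ => hyw t j ht, hw.extend_apply]
    have huw' : (fun j => u (w' j)) = W' := by
      funext j
      simp only [u]
      rw [Function.extend_apply' _ _ _ fun ⟨t, ht⟩ => hyw' t j ht,
        Function.extend_apply' _ _ _ fun ⟨t, ht⟩ => hww' t j ht, hw'.extend_apply]
    have hu : ∀ j < M + 2, u j = if j < M then u₀ j else if j = M then a else b := by
      intro j hj
      simp only [u]
      rw [Function.extend_apply' _ _ _ fun ⟨t, ht⟩ => by simp only [y] at ht; omega,
        Function.extend_apply' _ _ _ fun ⟨t, ht⟩ => by simp only [w] at ht; omega,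
        Function.extend_apply' _ _ _ fun ⟨t, ht⟩ => by simp only [w'] at ht; omega]
    refine ⟨_, _, u, ?_, ?_, Or.inr ⟨y, w, w', M, M + 1, k, _, _, rfl, rfl, rfl, rfl⟩,
      fun j hj => ?_, ?_⟩
    · simp only [List.nodup_cons, List.nodup_append, List.nodup_ofFn, List.mem_cons,
        List.mem_append, List.mem_ofFn', not_or]
      refine ⟨⟨by omega, ⟨?_, ?_⟩, ?_⟩, ⟨⟨?_, ?_⟩, ?_⟩, ⟨hy, hw, ?_⟩, hw', ?_⟩
      · rintro ⟨t, ht⟩; simp only [y] at ht; omega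
      · rintro ⟨t, ht⟩; simp only [w] at ht; omega
      · rintro ⟨t, ht⟩; simp only [w'] at ht; omega
      · rintro ⟨t, ht⟩; simp only [y] at ht; omega
      · rintro ⟨t, ht⟩; simp only [w] at ht; omega
      · rintro ⟨t, ht⟩; simp only [w'] at ht; omega
      · rintro _ ⟨t, rfl⟩ _ ⟨s, rfl⟩; exact hyw t s
      · rintro _ (⟨t, rfl⟩ | ⟨t, rfl⟩) _ ⟨s, rfl⟩
        · exact hyw' t s
        · exact hww' t s
    · simp only [List.mem_cons, List.mem_append, List.mem_ofFn']
      rintro j (rfl | rfl | (⟨t, rfl⟩ | ⟨t, rfl⟩) | ⟨t, rfl⟩)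
      · rfl
      · omega
      · simp only [y]; omega
      · simp only [w]; omega
      · simp only [w']; omega
    · rw [hu j (by omega), if_pos hj]
    · have e1 := hu M (by omega)
      have e2 := hu (M + 1) (by omega)
      simp at e1 e2
      rw [bondCommutator, ← e1, ← e2, ← huw, ← huw', ← huy,
        ← eval_extend_capelliPoly (F := F) hy hyw u, ← eval_extend_capelliPoly (F := F) hy hyw' u,
        ← eval_extend_coeffPoly hy k hya, ← eval_extend_coeffPoly hy k hya]
      simp only [extend_self hy, eval_sub, eval_mul, eval_capelliPoly, eval_X]
      rfl

theorem IsCommutatorValue.map {B : Type*} [Ring B] [Algebra F B] (φ : A →ₐ[F] B) {m : ℕ} {c : A}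
    (hc : IsCommutatorValue m c) : IsCommutatorValue m (φ c) := by
  obtain ⟨l, C, u, hl, -, hC, -, rfl⟩ := exists_eval_eq_of_isCommutatorValue (F := F) hc 0 0
  rw [map_eval]
  exact isCommutatorValue_eval hl hC _

/-- For `d < m` the Capelli polynomial vanishes by dimension; for `d = m` the scalar is a
characteristic coefficient, or `0` when `k` exceeds `m ^ 2`. That `χ` does not depend on `W` lets
both factors of a bond commutator share it. -/
theorem coeffOp_eq_smul {K : Type*} [Field K] [Infinite K] {d m : ℕ} (hd : d ≤ m) (k : ℕ)
    (a : Matrix (Fin d) (Fin d) K) : ∃ χ : K, ∀ W : Fin (m ^ 2) → Matrix (Fin d) (Fin d) K,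
      coeffOp k a (fun Y => capelli Y W) = χ • fun Y => capelli Y W := by
  rcases hd.lt_or_eq with h | rfl
  · refine ⟨0, fun W => ?_⟩
    have : ∀ Y : Fin (m ^ 2) → Matrix (Fin d) (Fin d) K, capelli Y W = 0 := fun Y =>
      capelli_eq_zero_of_finrank_lt K (by
        rw [Module.finrank_matrix]; simp only [Fintype.card_fin, Module.finrank_self]; nlinarith) _ _
    funext Y
    simp [coeffOp, this]
  · by_cases hk : k ≤ d ^ 2
    · exact ⟨charCoeff k a, fun W => coeffOp_capelli hk a W⟩
    · exact ⟨0, fun W => by rw [coeffOp_of_lt (by omega), zero_smul]⟩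

/-- Commutators of matrix degree `m` vanish on matrices of size at most `m`. -/
theorem IsCommutatorValue.eq_zero {K : Type*} [Field K] [Infinite K] {d m : ℕ} (hd : d ≤ m)
    {c : Matrix (Fin d) (Fin d) K} (hc : IsCommutatorValue m c) : c = 0 := by
  rcases hc with ⟨k, k', a, b, L, Y, W, rfl⟩ | ⟨k, a, b, Y, W, W', rfl⟩
  · have hL : ∃ χ : K, coeffOps L (fun Y => capelli Y W) = χ • fun Y => capelli Y W := by
      induction L with
      | nil => exact ⟨1, by rw [one_smul]; rfl⟩
      | cons s L ih =>
        obtain ⟨χ, hχ⟩ := ih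
        obtain ⟨χ', hχ'⟩ := coeffOp_eq_smul hd s.2 s.1
        refine ⟨χ * χ', ?_⟩
        change coeffOp s.2 s.1 (coeffOps L _) = _
        rw [hχ, coeffOp_smul, hχ', smul_smul]
    obtain ⟨χ, hχ⟩ := hL
    obtain ⟨χa, ha⟩ := coeffOp_eq_smul hd k a
    obtain ⟨χb, hb⟩ := coeffOp_eq_smul hd k' b
    rw [operatorCommutator, hχ]
    simp only [coeffOp_smul, ha, hb, smul_smul]
    rw [mul_assoc, mul_assoc, mul_comm χb, sub_self]
  · obtain ⟨χ, hχ⟩ := coeffOp_eq_smul hd k a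
    rw [bondCommutator, hχ, hχ]
    simp [mul_assoc]

end CommutatorValues

/-! ### The effect of hikes on evaluations. -/

section Hikes

variable {F A : Type*} [Field F] [Ring A] [Algebra F A]

theorem eval_update_subst {i : ℕ} {u : NCPoly F} (hu : Avoids i u) (g : NCPoly F) (v : ℕ → A)
    (x : A) : eval (Function.update v i x) (subst i (u * X F i) g) =
      eval (Function.update v i (eval v u * x)) g := by
  rw [eval_subst, eval_mul, eval_X, eval_update_of_avoids hu, Function.update_self,
    Function.update_idem]

theorem avoids_commutator {i m : ℕ} {l : List ℕ} {C : NCPoly F} (hl : ∀ j ∈ l, j ≠ i)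
    (hC : IsOperatorCommutator m l C ∨ IsBondCommutator m l C) : Avoids i C := by
  rcases hC with ⟨y, w, a, b, k, k', L, rfl, rfl⟩ | ⟨y, w, w', a, v, k, E, E', rfl, rfl, rfl, rfl⟩
  · have ha : Avoids i (X F a) := avoids_X (hl a (by simp))
    have hb : Avoids i (X F b) := avoids_X (hl b (by simp))
    have hc : Avoids i (coeffWord (idx y) L (capelliPoly F y w)) := by
      refine avoids_coeffWord _ _ (fun s hs => hl _ ?_) (avoids_capelliPoly
        (fun j => hl _ (by simp)) (fun j => hl _ (by simp)))
      have : s.1 ∈ L.map Prod.fst := List.mem_map_of_mem hs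
      simp only [List.mem_cons, List.mem_append]
      tauto
    exact Subalgebra.sub_mem _
      (avoids_coeffPoly _ _ ha (avoids_coeffPoly _ _ hb hc))
      (avoids_coeffPoly _ _ hb (avoids_coeffPoly _ _ ha hc))
  · have ha : Avoids i (X F a) := avoids_X (hl a (by simp))
    have hv : Avoids i (X F v) := avoids_X (hl v (by simp))
    have hc : Avoids i (capelliPoly F y w) :=
      avoids_capelliPoly (fun j => hl _ (by simp)) (fun j => hl _ (by simp))
    have hc' : Avoids i (capelliPoly F y w') :=
      avoids_capelliPoly (fun j => hl _ (by simp)) (fun j => hl _ (by simp))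
    have hE := Subalgebra.mul_mem _ (Subalgebra.mul_mem _ hc hv) hc'
    have hE' := Subalgebra.mul_mem _ (Subalgebra.mul_mem _
      (avoids_coeffPoly (idx y) k ha hc) hv) (avoids_coeffPoly (idx y) k ha hc')
    exact Subalgebra.sub_mem _ (Subalgebra.mul_mem _ hE hE') (Subalgebra.mul_mem _ hE' hE)

/-- A commutator hike multiplies the argument at `x_i` by a commutator value. -/
theorem IsCommutatorHike.exists_eval {m i : ℕ} {g g' : NCPoly F} (h : IsCommutatorHike m i g g')
    (v : ℕ → A) : ∃ b c : A, IsCommutatorValue m c ∧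
      ∀ x, eval (Function.update v i x) g' = eval (Function.update v i (b * c * x)) g := by
  obtain ⟨z, l, C, ⟨hnd, hfr⟩, hC, rfl⟩ := h
  refine ⟨v z, eval v C, isCommutatorValue_eval (List.nodup_cons.1 hnd).2 hC v, fun x => ?_⟩
  have hCi : Avoids i C :=
    avoids_commutator (fun j hj => (hfr j (List.mem_cons_of_mem _ hj)).1) hC
  rw [eval_update_subst (Subalgebra.mul_mem _ (avoids_X (hfr z (by simp)).1) hCi), eval_mul,
    eval_X]

theorem QuasiLinearAt.hike {m i : ℕ} {g g' : NCPoly F} (hg : QuasiLinearAt A i g)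
    (h : IsCommutatorHike m i g g') : QuasiLinearAt A i g' := by
  intro v a a'
  obtain ⟨b, c, -, hx⟩ := h.exists_eval v
  rw [hx, hx, hx, mul_add, hg]

theorem QuasiLinearAt.eval_zero {i : ℕ} {g : NCPoly F} (hg : QuasiLinearAt A i g) (v : ℕ → A) :
    eval (Function.update v i 0) g = 0 := by
  have := hg v 0 0
  rw [add_zero] at this
  exact left_eq_add.1 this

variable (A) in
/-- The polynomial `g` vanishes when the value of `x_i` is `z c_{d²}(y;w) x`. -/
def VanishesOnCapelli (i d : ℕ) (g : NCPoly F) : Prop :=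
  ∀ (v : ℕ → A) (y w : Fin (d ^ 2) → A) (z x : A),
    eval (Function.update v i (z * capelli y w * x)) g = 0

/-- The factor contributed by the hike stands to the left of the Capelli value and is absorbed into
`z`. -/
theorem VanishesOnCapelli.hike {m i d : ℕ} {g g' : NCPoly F} (hg : VanishesOnCapelli A i d g)
    (h : IsCommutatorHike m i g g') : VanishesOnCapelli A i d g' := by
  intro v y w z x
  obtain ⟨b, c, -, hx⟩ := h.exists_eval v
  rw [hx, ← mul_assoc, ← mul_assoc]
  exact hg v y w _ x

end Hikes

/-! ### Blocks of `A` and termination of hikes. -/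

section Blocks

variable {F K : Type*} [Field F] [Field K] [Algebra F K] {n : ℕ}
  (A : Subalgebra F (Matrix (Fin n) (Fin n) K))

/-- The restriction to `A` of a representation of the `K`-algebra spanned by `A`. -/
def blockHom {A : Subalgebra F (Matrix (Fin n) (Fin n) K)} {d : ℕ}
    (π : Algebra.adjoin K (A : Set (Matrix (Fin n) (Fin n) K)) →ₐ[K]
      Matrix (Fin d) (Fin d) K) : A →ₐ[F] Matrix (Fin d) (Fin d) K where
  toFun a := π ⟨a.1, Algebra.subset_adjoin a.2⟩
  map_one' := map_one π
  map_zero' := map_zero π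
  map_add' a b := map_add π ⟨a.1, Algebra.subset_adjoin a.2⟩ ⟨b.1, Algebra.subset_adjoin b.2⟩
  map_mul' a b := map_mul π ⟨a.1, Algebra.subset_adjoin a.2⟩ ⟨b.1, Algebra.subset_adjoin b.2⟩
  commutes' r := by
    rw [IsScalarTower.algebraMap_apply F K (Matrix (Fin d) (Fin d) K), ← π.commutes]
    congr 1

variable {A} in
-- Allows the nonvanishing of a Capelli polynomial on a block to be tested, by multilinearity, on
-- images of elements of `A`.
theorem span_range_blockHom {d : ℕ} {π : Algebra.adjoin K (A : Set (Matrix (Fin n) (Fin n) K)) →ₐ[K]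
    Matrix (Fin d) (Fin d) K} (hπ : Function.Surjective π) :
    Submodule.span K (Set.range (blockHom π)) = ⊤ := by
  rw [eq_top_iff]
  rintro y -
  obtain ⟨⟨b, hb⟩, rfl⟩ := hπ y
  have hb' := (mem_adjoin_iff_mem_span A b).1 hb
  have key : ∀ b ∈ Submodule.span K (A : Set (Matrix (Fin n) (Fin n) K)),
      ∀ hb : b ∈ Algebra.adjoin K (A : Set (Matrix (Fin n) (Fin n) K)),
        π ⟨b, hb⟩ ∈ Submodule.span K (Set.range (blockHom π)) := by
    intro b hb
    induction hb using Submodule.span_induction with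
    | mem x hx => exact fun _ => Submodule.subset_span ⟨⟨x, hx⟩, rfl⟩
    | zero => intro h; exact (map_zero π).symm ▸ zero_mem _
    | add x y hx hy h1 h2 =>
      intro h
      have e1 := (mem_adjoin_iff_mem_span A x).2 hx
      have e2 := (mem_adjoin_iff_mem_span A y).2 hy
      have := add_mem (h1 e1) (h2 e2)
      rwa [← map_add] at this
    | smul c x hx h1 =>
      intro h
      have e1 := (mem_adjoin_iff_mem_span A x).2 hx
      have := Submodule.smul_mem _ c (h1 e1)
      rwa [← map_smul] at this
  exact key b hb' hb

variable {A} in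
theorem IsBlockDegree.le {d : ℕ} (h : IsBlockDegree A d) : d ≤ n := by
  obtain ⟨-, π, hπ⟩ := h
  have h1 := LinearMap.finrank_le_finrank_of_surjective (f := π.toLinearMap) hπ
  have h2 := Submodule.finrank_le (Subalgebra.toSubmodule
    (Algebra.adjoin K (A : Set (Matrix (Fin n) (Fin n) K))))
  have h3 := h1.trans h2
  simp only [Module.finrank_matrix, Fintype.card_fin, Module.finrank_self, mul_one] at h3
  exact Nat.mul_self_le_mul_self_iff.1 h3

/-- The ideal of `A` generated by the values of the Capelli polynomials `c_{d²}`, for the block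
degrees `d > m`. -/
def capelliIdeal (m : ℕ) : Submodule F (Matrix (Fin n) (Fin n) K) :=
  Submodule.span F {t | ∃ d, IsBlockDegree A d ∧ m < d ∧ ∃ (y w : Fin (d ^ 2) → A) (z x : A),
    t = ((z * capelli y w * x : A) : Matrix (Fin n) (Fin n) K)}

theorem capelliIdeal_le (m : ℕ) : capelliIdeal A m ≤ Subalgebra.toSubmodule A := by
  refine Submodule.span_le.2 ?_
  rintro _ ⟨d, -, -, y, w, z, x, rfl⟩
  exact Subtype.prop _

theorem mul_mem_capelliIdeal_left (m : ℕ) : ∀ a ∈ A, ∀ x ∈ capelliIdeal A m,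
    a * x ∈ capelliIdeal A m := by
  intro a ha x hx
  induction hx using Submodule.span_induction with
  | mem x hx =>
    obtain ⟨d, hd, hm, y, w, z, x, rfl⟩ := hx
    exact Submodule.subset_span ⟨d, hd, hm, y, w, ⟨a, ha⟩ * z, x, by simp [mul_assoc]⟩
  | zero => simp
  | add x y _ _ hx hy => rw [mul_add]; exact add_mem hx hy
  | smul r x _ hx => rw [mul_smul_comm]; exact Submodule.smul_mem _ _ hx

theorem mul_mem_capelliIdeal_right (m : ℕ) : ∀ a ∈ A, ∀ x ∈ capelliIdeal A m,
    x * a ∈ capelliIdeal A m := by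
  intro a ha x hx
  induction hx using Submodule.span_induction with
  | mem x hx =>
    obtain ⟨d, hd, hm, y, w, z, x, rfl⟩ := hx
    exact Submodule.subset_span ⟨d, hd, hm, y, w, z, x * ⟨a, ha⟩, by simp [mul_assoc]⟩
  | zero => simp
  | add x y _ _ hx hy => rw [add_mul]; exact add_mem hx hy
  | smul r x _ hx => rw [smul_mul_assoc]; exact Submodule.smul_mem _ _ hx

/-- The elements of `A` that vanish in all blocks of degree at most `m`. -/
def smallBlocksKernel (m : ℕ) : Submodule F (Matrix (Fin n) (Fin n) K) :=
  Submodule.map A.val.toLinearMap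
    (⨅ (d : ℕ) (_ : 0 < d ∧ d ≤ m) (π : {π : Algebra.adjoin K
      (A : Set (Matrix (Fin n) (Fin n) K)) →ₐ[K] Matrix (Fin d) (Fin d) K //
        Function.Surjective π}), LinearMap.ker (blockHom π.1).toLinearMap)

theorem coe_mem_smallBlocksKernel {m : ℕ} {a : A} :
    (a : Matrix (Fin n) (Fin n) K) ∈ smallBlocksKernel A m ↔ ∀ (d : ℕ)
      (π : Algebra.adjoin K (A : Set (Matrix (Fin n) (Fin n) K)) →ₐ[K] Matrix (Fin d) (Fin d) K),
        0 < d → d ≤ m → Function.Surjective π → blockHom π a = 0 := by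
  rw [smallBlocksKernel, Submodule.mem_map]
  constructor
  · rintro ⟨b, hb, hba⟩ d π h1 h2 h3
    obtain rfl : b = a := Subtype.ext hba
    simp only [Submodule.mem_iInf] at hb
    exact hb d ⟨h1, h2⟩ ⟨π, h3⟩
  · intro h
    refine ⟨a, ?_, rfl⟩
    simp only [Submodule.mem_iInf]
    exact fun d hd π => h d π.1 hd.1 hd.2 π.2

theorem smallBlocksKernel_le (m : ℕ) : smallBlocksKernel A m ≤ Subalgebra.toSubmodule A := by
  rintro _ ⟨a, -, rfl⟩
  exact a.2

variable {A} in
theorem IsCommutatorValue.mul_mem_smallBlocksKernel [Infinite K] {m : ℕ} {c : A}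
    (hc : IsCommutatorValue m c) (b : A) :
    ((b * c : A) : Matrix (Fin n) (Fin n) K) ∈ smallBlocksKernel A m := by
  rw [coe_mem_smallBlocksKernel]
  intro d π _ hd _
  rw [map_mul, (hc.map (blockHom π)).eq_zero hd, mul_zero]

/-- A surjection onto `M_d(K)` killing the Capelli ideal must have `d ≤ m`: otherwise `c_{d²}` would
vanish on a spanning set of `M_d(K)`, hence everywhere. Surjections with `d ≤ m` kill
`smallBlocksKernel A m` by definition. -/
theorem exists_smallBlocksKernel_pow_le [IsAlgClosed K] (m : ℕ) :
    ∃ s : ℕ, ∀ x ∈ smallBlocksKernel A m ^ s,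
      x ∈ zariskiClosure (capelliIdeal A m : Set (Matrix (Fin n) (Fin n) K)) := by
  refine exists_pow_killed_le_closure (capelliIdeal_le A m) (mul_mem_capelliIdeal_left A m)
    (mul_mem_capelliIdeal_right A m) _ (smallBlocksKernel_le A m) ?_
  intro d π hd hπ hN x hx
  by_cases hdm : d ≤ m
  · have hxA : x.1 ∈ A := smallBlocksKernel_le A m hx
    exact (coe_mem_smallBlocksKernel A (a := ⟨x.1, hxA⟩)).1 hx d π hd hdm hπ
  · obtain ⟨y, w, hyw⟩ := exists_capelli_ne_zero K hd
    refine absurd (capelli_eq_zero_of_span (span_range_blockHom hπ) ?_ y w) hyw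
    intro y w hy hw
    choose y' hy' using hy
    choose w' hw' using hw
    have : capelli y w = blockHom π (capelli y' w') := by
      rw [map_capelli]; simp only [hy', hw']
    rw [this]
    refine hN ⟨(capelli y' w' : A).1, _⟩ (Submodule.subset_span
      ⟨d, ⟨hd, π, hπ⟩, not_le.1 hdm, y', w', 1, 1, ?_⟩)
    simp

variable {A} in
/-- A quasi-linear polynomial that vanishes on the Capelli values vanishes on the Zariski closure of
the ideal they generate. -/
theorem QuasiLinearAt.eval_eq_zero_of_mem_closure {i m : ℕ} {g : NCPoly F}
    (hg : QuasiLinearAt A i g)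
    (hv : ∀ d, IsBlockDegree A d → m < d → VanishesOnCapelli A i d g) {x : A}
    (hx : (x : Matrix (Fin n) (Fin n) K) ∈
      zariskiClosure (capelliIdeal A m : Set (Matrix (Fin n) (Fin n) K))) (v : ℕ → A) :
    eval (Function.update v i x) g = 0 := by
  have hcoe : ∀ x : A, ((eval (Function.update v i x) g : A) : Matrix (Fin n) (Fin n) K) =
      eval (Function.update (fun j => (v j : Matrix (Fin n) (Fin n) K)) i x) g := by
    intro x
    refine (map_eval A.val _ g).trans ?_
    congr 1
    funext j
    by_cases h : j = i
    · subst h; simp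
    · simp [Function.update_of_ne h]
  -- The left factor `b` is carried along for the scalar step: `g` is additive but perhaps not
  -- `F`-homogeneous in `x_i`, so a scalar must be moved into `b`.
  have hN : ∀ s ∈ capelliIdeal A m, ∃ h : s ∈ A, ∀ b : A,
      eval (Function.update v i (b * ⟨s, h⟩)) g = 0 := by
    intro s hs
    induction hs using Submodule.span_induction with
    | mem s hs =>
      obtain ⟨d, hd, hm, y, w, z, x, rfl⟩ := hs
      refine ⟨Subtype.prop _, fun b => ?_⟩
      have := hv d hd hm v y w (b * z) x
      rwa [mul_assoc, mul_assoc, ← mul_assoc z] at this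
    | zero =>
      refine ⟨A.zero_mem, fun b => ?_⟩
      have : b * ⟨0, A.zero_mem⟩ = 0 := mul_zero b
      rw [this, hg.eval_zero]
    | add s t _ _ hs ht =>
      obtain ⟨h1, hs⟩ := hs
      obtain ⟨h2, ht⟩ := ht
      refine ⟨A.add_mem h1 h2, fun b => ?_⟩
      have : b * ⟨s + t, A.add_mem h1 h2⟩ = b * ⟨s, h1⟩ + b * ⟨t, h2⟩ :=
        mul_add b ⟨s, h1⟩ ⟨t, h2⟩
      rw [this, hg, hs, ht, add_zero]
    | smul r s _ hs =>
      obtain ⟨h1, hs⟩ := hs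
      refine ⟨A.smul_mem h1 r, fun b => ?_⟩
      have : b * ⟨r • s, A.smul_mem h1 r⟩ = (r • b) * ⟨s, h1⟩ :=
        (mul_smul_comm r b (⟨s, h1⟩ : A)).trans (smul_mul_assoc r b (⟨s, h1⟩ : A)).symm
      rw [this, hs]
  refine Subtype.ext ?_
  rw [hcoe]
  refine (isPolyMap_eval _ i g).eq_zero (fun s hs => ?_) hx
  obtain ⟨h, hb⟩ := hN s hs
  have := hb 1
  rw [one_mul] at this
  rw [← hcoe ⟨s, h⟩, this]; rfl

/-- The polynomials reached from `f` by commutator hikes that are not identities of `A` and vanish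
on the Capelli values of all block degrees exceeding `m`. -/
structure IsReached (f : NCPoly F) (i m : ℕ) (g : NCPoly F) : Prop where
  reach : Relation.ReflTransGen
    (fun u u' => ∃ d, IsBlockDegree A d ∧ IsCommutatorHike d i u u') f g
  quasi : QuasiLinearAt A i g
  nonid : ¬ IsIdentity A g
  vanishes : ∀ d, IsBlockDegree A d → m < d → VanishesOnCapelli A i d g

variable {A} in
theorem IsReached.hike {f : NCPoly F} {i m d : ℕ} {g g' : NCPoly F} (h : IsReached A f i m g)
    (hd : IsBlockDegree A d) (hh : IsCommutatorHike d i g g') (hn : ¬ IsIdentity A g') :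
    IsReached A f i m g' :=
  ⟨h.reach.tail ⟨d, hd, hh⟩, h.quasi.hike hh, hn, fun e he hm => (h.vanishes e he hm).hike hh⟩

/-- The polynomial `g` does not vanish on the products of `s` elements of `smallBlocksKernel A m`. -/
def NonvanishingOnPow (i m s : ℕ) (g : NCPoly F) : Prop :=
  ∃ (v : ℕ → A) (b x : A), (b : Matrix (Fin n) (Fin n) K) ∈ smallBlocksKernel A m ^ s ∧
    eval (Function.update v i (b * x)) g ≠ 0

variable {A}

theorem exists_eval_update_ne_zero {i : ℕ} {g : NCPoly F} (h : ¬ IsIdentity A g) :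
    ∃ (v : ℕ → A) (x : A), eval (Function.update v i x) g ≠ 0 := by
  rw [IsIdentity, not_forall] at h
  obtain ⟨v, hv⟩ := h
  exact ⟨v, v i, by rwa [Function.update_eq_self]⟩

/-- The exponent depends only on `A` and `m`, so it bounds the hikes from every reached polynomial
at once. -/
theorem exists_not_nonvanishingOnPow [IsAlgClosed K] (f : NCPoly F) (i m : ℕ) :
    ∃ s, ∀ g, IsReached A f i m g → ¬ NonvanishingOnPow A i m s g := by
  obtain ⟨s, hs⟩ := exists_smallBlocksKernel_pow_le A m
  refine ⟨s, ?_⟩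
  intro g hg hne
  obtain ⟨v, b, x, hb, h⟩ := hne
  have hbx : ((b * x : A) : Matrix (Fin n) (Fin n) K) ∈
      zariskiClosure (capelliIdeal A m : Set (Matrix (Fin n) (Fin n) K)) := by
    rw [MulMemClass.coe_mul]
    exact closure_mul_mem_right (mul_mem_capelliIdeal_right A m) x.2 (hs _ hb)
  exact h (hg.quasi.eval_eq_zero_of_mem_closure hg.vanishes hbx v)

/-- The hike inserts `z * c` with `c` a commutator value, which is one more factor from the kernel.
-/
theorem NonvanishingOnPow.of_hike [Infinite K] {i m s : ℕ} {g g' : NCPoly F}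
    (h : NonvanishingOnPow A i m s g') (hh : IsCommutatorHike m i g g') :
    NonvanishingOnPow A i m (s + 1) g := by
  obtain ⟨v, b, x, hb, hne⟩ := h
  obtain ⟨z, c, hc, hx⟩ := hh.exists_eval v
  refine ⟨v, z * c * b, x, ?_, ?_⟩
  · rw [pow_succ']
    exact Submodule.mul_mem_mul (hc.mul_mem_smallBlocksKernel z) hb
  · rwa [hx, ← mul_assoc] at hne

theorem nonvanishingOnPow_zero {i m : ℕ} {g : NCPoly F} (h : ¬ IsIdentity A g) :
    NonvanishingOnPow A i m 0 g := by
  obtain ⟨v, x, hx⟩ := exists_eval_update_ne_zero (i := i) h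
  refine ⟨v, 1, x, ?_, by rwa [one_mul]⟩
  rw [pow_zero]
  exact Submodule.one_le.1 le_rfl

/-- Commutator hikes at the largest block degree that matters terminate. -/
theorem exists_terminal [IsAlgClosed K] {f : NCPoly F} {i : ℕ} (hquasi : QuasiLinearAt A i f)
    (hnonid : ¬ IsIdentity A f) :
    ∃ (m : ℕ) (g : NCPoly F), IsReached A f i m g ∧ IsBlockDegree A m ∧
      ¬ VanishesOnCapelli A i m g ∧
      ∀ g', IsCommutatorHike m i g g' → IsIdentity A g' := by
  classical
  -- No block degree exceeds `n`, so `f` itself qualifies for `m = n`.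
  have hex : ∃ m g, IsReached A f i m g :=
    ⟨n, f, .refl, hquasi, hnonid, fun d hd hlt => absurd hd.le (not_le.2 hlt)⟩
  obtain ⟨g₀, hg₀⟩ := Nat.find_spec hex
  have hmin := fun m => Nat.find_min hex (m := m)
  set m := Nat.find hex
  obtain ⟨s, hs⟩ := exists_not_nonvanishingOnPow (A := A) f i m
  -- For `m = 0` the kernel is all of `A`, so `1` lies in each of its powers and `g₀` would be an
  -- identity.
  have hm : m ≠ 0 := by
    intro h0
    refine hs g₀ hg₀ ?_
    obtain ⟨v, x, hx⟩ := exists_eval_update_ne_zero (i := i) hg₀.nonid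
    refine ⟨v, 1, x, ?_, by rwa [one_mul]⟩
    have h1 : ((1 : A) : Matrix (Fin n) (Fin n) K) ∈ smallBlocksKernel A m := by
      rw [coe_mem_smallBlocksKernel]
      intro d π h1 h2
      omega
    have := Submodule.pow_mem_pow _ h1 s
    simpa using this
  -- If either claim failed, `g` would already qualify for `m - 1`.
  have hblock : ∀ g, IsReached A f i m g → IsBlockDegree A m ∧ ¬ VanishesOnCapelli A i m g := by
    intro g hg
    by_contra hcon
    refine hmin (m - 1) (by omega) ⟨g, hg.reach, hg.quasi, hg.nonid, fun d hd hlt => ?_⟩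
    rcases eq_or_lt_of_le (show m ≤ d by omega) with rfl | h
    · by_contra hv
      exact hcon ⟨hd, hv⟩
    · exact hg.vanishes d hd h
  by_contra hcon
  have hstep : ∀ g, IsReached A f i m g → ∃ g', IsReached A f i m g' ∧
      IsCommutatorHike m i g g' := by
    intro g hg
    by_contra hc
    refine hcon ⟨m, g, hg, (hblock g hg).1, (hblock g hg).2, fun g' hg' => ?_⟩
    by_contra hn
    exact hc ⟨g', hg.hike (hblock g hg).1 hg' hn, hg'⟩
  -- If a non-identity hike always existed, `t` successive hikes would show nonvanishing on the
  -- `t`-th power of the kernel for every `t`, contrary to the bound `s`.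
  have hall : ∀ t, ∀ g, IsReached A f i m g → NonvanishingOnPow A i m t g := by
    intro t
    induction t with
    | zero => exact fun g hg => nonvanishingOnPow_zero hg.nonid
    | succ t ih =>
      intro g hg
      obtain ⟨g', hg', hh⟩ := hstep g hg
      exact (ih g' hg').of_hike hh
  exact hs g₀ hg₀ (hall s g₀ hg₀)

end Blocks

/-! ### Commuting coefficient operators. -/

section Operators

variable {F A : Type*} [Field F] [Ring A] [Algebra F A]

/-- A polynomial all of whose commutator hikes are identities vanishes on all commutator values. -/
theorem eval_commutatorValue_eq_zero {i m M : ℕ} {g : NCPoly F} (hiM : i < M)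
    (hM : g ∈ Algebra.adjoin F (X F '' Set.Iio M))
    (hid : ∀ g', IsCommutatorHike m i g g' → IsIdentity A g') {c : A}
    (hc : IsCommutatorValue m c) (v : ℕ → A) (b x : A) :
    eval (Function.update v i (b * c * x)) g = 0 := by
  -- Index `M` is reserved for the indeterminate `z` with value `b`; the commutator uses indices
  -- from `M + 1` on.
  obtain ⟨l, C, u, hl, hlM, hC, hu, rfl⟩ := exists_eval_eq_of_isCommutatorValue (F := F) hc (M + 1)
    (Function.update v M b)
  have hli : ∀ j ∈ l, j ≠ i := fun j hj => by have := hlM j hj; omega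
  have hfresh : Fresh i g (M :: l) := by
    refine ⟨List.nodup_cons.2 ⟨fun h => ?_, hl⟩, fun j hj => ?_⟩
    · have := hlM M h; omega
    · have : M ≤ j := by
        rcases List.mem_cons.1 hj with rfl | hj
        · rfl
        · have := hlM j hj; omega
      exact ⟨by omega, avoids_of_mem_adjoin_Iio hM this⟩
  have h := hid _ ⟨M, l, C, hfresh, hC, rfl⟩ (Function.update u i x)
  rw [eval_update_subst (Subalgebra.mul_mem _ (avoids_X (by omega)) (avoids_commutator hli hC)),
    eval_mul, eval_X, hu M (by omega), Function.update_self] at h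
  rw [← h]
  refine eval_congr hM fun j hj => ?_
  by_cases hji : j = i
  · subst hji; simp
  · have hj' : j < M := hj
    rw [Function.update_of_ne hji, Function.update_of_ne hji, hu j (by omega),
      Function.update_of_ne (by omega)]

/-- The operator `alphaPol` as a linear map. -/
def alphaPolLinear (F : Type*) {A : Type*} [Field F] [Ring A] [Algebra F A] (Y : Finset ℕ)
    (q k : ℕ) (a : A) : ((ℕ → A) → A) →ₗ[F] ((ℕ → A) → A) where
  toFun := alphaPol Y q k a
  map_add' Φ Ψ := by
    funext v
    simp [alphaPol, Finset.sum_add_distrib]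
  map_smul' r Φ := by
    funext v
    simp [alphaPol, Finset.smul_sum]

/-- The operators `alphaPol` commute on a module generated by a function that factors through the
Capelli polynomial by an additive map vanishing on commutator values. -/
theorem alphaPol_comm_of_mem_coeffModule {m : ℕ} {y w : Fin (m ^ 2) → ℕ}
    (hy : Function.Injective y) (T : (ℕ → A) → A →+ A)
    (hT : ∀ v c, IsCommutatorValue m c → T v c = 0) {Φ₀ : (ℕ → A) → A}
    (hΦ₀ : ∀ v Y, Φ₀ (Function.extend y Y v) = T v (capelli Y fun j => v (w j)))
    {Φ : (ℕ → A) → A} (hΦ : Φ ∈ coeffModule F (idx y) Φ₀) (q q' k l : ℕ) (a b : A) :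
    alphaPol (idx y) q k a (alphaPol (idx y) q' l b Φ) =
      alphaPol (idx y) q' l b (alphaPol (idx y) q k a Φ) := by
  -- These functions are `T v` applied to coefficient words of the Capelli polynomial, with one word
  -- for all backgrounds `v`. Additivity of `T v` makes the set stable under the operators, so its
  -- span contains the whole module.
  let G : Set ((ℕ → A) → A) := {Φ | ∃ L : List (A × ℕ), ∀ v,
    (fun Y => Φ (Function.extend y Y v)) =
      fun Y => T v (coeffOps L (fun Y => capelli Y fun j => v (w j)) Y)}
  have hstable : ∀ q k a, ∀ Ψ ∈ G, alphaPol (idx y) q k a Ψ ∈ G := by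
    rintro q k a Ψ ⟨L, hL⟩
    refine ⟨(a ^ q, k) :: L, fun v => ?_⟩
    funext Y
    rw [alphaPol_extend hy, hL, coeffOp_comp]; rfl
  have hle : coeffModule F (idx y) Φ₀ ≤ Submodule.span F G := by
    refine sInf_le ⟨Submodule.subset_span ⟨[], fun v => funext fun Y => hΦ₀ v Y⟩, ?_⟩
    intro q k a
    have : Submodule.span F G ≤ (Submodule.span F G).comap (alphaPolLinear F (idx y) q k a) :=
      Submodule.span_le.2 fun Ψ hΨ => Submodule.subset_span (hstable q k a Ψ hΨ)
    exact fun Ψ hΨ => this hΨ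
  have hcomm : Submodule.span F G ≤ LinearMap.eqLocus
      (alphaPolLinear F (idx y) q k a ∘ₗ alphaPolLinear F (idx y) q' l b)
      (alphaPolLinear F (idx y) q' l b ∘ₗ alphaPolLinear F (idx y) q k a) := by
    refine Submodule.span_le.2 ?_
    rintro Ψ ⟨L, hL⟩
    change alphaPol (idx y) q k a (alphaPol (idx y) q' l b Ψ) =
      alphaPol (idx y) q' l b (alphaPol (idx y) q k a Ψ)
    have key : ∀ (q q' k l : ℕ) (a b : A) (v : ℕ → A) (Y : Fin (m ^ 2) → A),
        alphaPol (idx y) q k a (alphaPol (idx y) q' l b Ψ) (Function.extend y Y v) =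
          T v (coeffOp k (a ^ q) (coeffOp l (b ^ q')
            (coeffOps L fun Y => capelli Y fun j => v (w j))) Y) := by
      intro q q' k l a b v Y
      rw [alphaPol_extend hy]
      simp only [alphaPol_extend hy]
      rw [hL v]
      have e : ∀ Y, coeffOp l (b ^ q') (fun Y => T v (coeffOps L
          (fun Y => capelli Y fun j => v (w j)) Y)) Y = T v (coeffOp l (b ^ q')
            (coeffOps L fun Y => capelli Y fun j => v (w j)) Y) := fun Y => by rw [coeffOp_comp]
      simp only [e]
      rw [coeffOp_comp]
    funext v
    -- The difference of the two orders is `T v` of an operator commutator value, hence zero.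
    rw [← extend_self hy v, key, key, ← sub_eq_zero, ← map_sub]
    exact hT _ _ (Or.inl ⟨k, l, a ^ q, b ^ q', L, _, _, rfl⟩)
  exact hcomm (hle hΦ)

/-- The polynomially defined characteristic coefficients on `M_m(K)`. -/
theorem alphaPol_capelliPoly (p : ℕ) [Fact p.Prime] {K : Type*} [Field K] [Infinite K] [CharP K p]
    [Algebra F K] {m : ℕ} {y w : Fin (m ^ 2) → ℕ} (hy : Function.Injective y)
    (hyw : ∀ t s, y t ≠ w s) {r k : ℕ} (hk : k ≤ m ^ 2) (a : Matrix (Fin m) (Fin m) K)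
    (v : ℕ → Matrix (Fin m) (Fin m) K) :
    alphaPol (idx y) (p ^ r) k a (fun v => eval v (capelliPoly F y w)) v =
      charCoeff k a ^ (p ^ r) • eval v (capelliPoly F y w) := by
  conv_lhs => rw [← extend_self hy v]
  rw [alphaPol_extend hy, eval_extend_capelliPoly hy hyw, coeffOp_capelli hk,
    charCoeff_pow_char_pow, eval_capelliPoly]
  rfl

end Operators

end Hiking
end

/-! ### The main theorem. -/

theorem mainTheorem6 (p : ℕ) [Fact p.Prime] {F K : Type*} [Field F] [CharP F p]
    [Field K] [IsAlgClosed K] [Algebra F K] {n : ℕ}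
    (A : Subalgebra F (Matrix (Fin n) (Fin n) K))
    (f : Hiking.NCPoly F) (i : ℕ)
    (hquasi : Hiking.QuasiLinearAt A i f) (hnonid : ¬ Hiking.IsIdentity A f) :
    ∃ (g h : Hiking.NCPoly F) (m z : ℕ) (y w : Fin (m ^ 2) → ℕ),
      Relation.ReflTransGen
        (fun u u' => ∃ d, Hiking.IsBlockDegree A d ∧ Hiking.IsCommutatorHike d i u u') f g ∧
      Hiking.IsBlockDegree A m ∧
      Hiking.Fresh i g (z :: (List.ofFn y ++ List.ofFn w)) ∧
      h = Hiking.subst i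
        (Hiking.X F z * Hiking.capelliPoly F y w * Hiking.X F i) g ∧
      ¬ Hiking.IsIdentity A h ∧
      (∀ Φ ∈ Hiking.coeffModule F (Hiking.idx y) (fun v : ℕ → A => Hiking.eval v h),
        ∀ (r s k l : ℕ) (a b : A),
          Hiking.alphaPol (Hiking.idx y) (p ^ r) k a
              (Hiking.alphaPol (Hiking.idx y) (p ^ s) l b Φ) =
            Hiking.alphaPol (Hiking.idx y) (p ^ s) l b
              (Hiking.alphaPol (Hiking.idx y) (p ^ r) k a Φ)) ∧
      (∀ h' : Hiking.NCPoly F, Hiking.IsCommutatorHike m i h h' → Hiking.IsIdentity A h') ∧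
      (∀ (r k : ℕ), k ≤ m ^ 2 → ∀ (a : Matrix (Fin m) (Fin m) K)
          (v : ℕ → Matrix (Fin m) (Fin m) K),
        Hiking.alphaPol (Hiking.idx y) (p ^ r) k a
            (fun v => Hiking.eval v (Hiking.capelliPoly F y w)) v =
          Hiking.charCoeff k a ^ (p ^ r) • Hiking.eval v (Hiking.capelliPoly F y w)) := by
  open Hiking in
  have : CharP K p := charP_of_injective_algebraMap (algebraMap F K).injective p
  have : Infinite K := IsAlgClosed.instInfinite
  obtain ⟨m, g, hg, hm, hnv, hid⟩ := exists_terminal hquasi hnonid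
  obtain ⟨M₀, hM₀⟩ := exists_mem_adjoin_Iio g
  obtain ⟨M, hiM, hM⟩ : ∃ M, i < M ∧ g ∈ Algebra.adjoin F (X F '' Set.Iio M) :=
    ⟨max M₀ (i + 1), by omega, Algebra.adjoin_mono (Set.image_mono
      (Set.Iio_subset_Iio (le_max_left _ _))) hM₀⟩
  set N := m ^ 2 with hN
  let y : Fin N → ℕ := fun j => M + 1 + j
  let w : Fin N → ℕ := fun j => M + 1 + N + j
  have hy : Function.Injective y := fun s t h => Fin.ext (by simpa [y] using h)
  have hw : Function.Injective w := fun s t h => Fin.ext (by simpa [w] using h)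
  have hyw : ∀ t s, y t ≠ w s := fun t s => by simp only [y, w]; omega
  have hyM : ∀ t, M < y t := fun t => by simp only [y]; omega
  have hwM : ∀ t, M < w t := fun t => by simp only [w]; omega
  have hav : Avoids i (X F M * capelliPoly F y w) := Subalgebra.mul_mem _ (avoids_X (by omega))
    (avoids_capelliPoly (fun j => by have := hyM j; omega) fun j => by have := hwM j; omega)
  have hkill : ∀ (c : A), IsCommutatorValue m c → ∀ (v : ℕ → A) (b x : A),
      eval (Function.update v i (b * c * x)) g = 0 := fun c hc v b x =>
    eval_commutatorValue_eq_zero hiM hM hid hc v b x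
  have hcongr : ∀ (u v : ℕ → A) (x : A), (∀ j < M, u j = v j) →
      eval (Function.update u i x) g = eval (Function.update v i x) g := by
    intro u v x huv
    refine eval_congr hM fun j hj => ?_
    by_cases hji : j = i
    · subst hji; simp
    · rw [Function.update_of_ne hji, Function.update_of_ne hji, huv j hj]
  refine ⟨g, _, m, M, y, w, hg.reach, hm, ⟨?_, ?_⟩, rfl, ?_, ?_, ?_, ?_⟩
  · simp only [List.nodup_cons, List.nodup_append, List.nodup_ofFn, List.mem_append,
      List.mem_ofFn', not_or]
    refine ⟨⟨?_, ?_⟩, hy, hw, ?_⟩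
    · rintro ⟨t, ht⟩; exact (hyM t).ne' ht
    · rintro ⟨t, ht⟩; exact (hwM t).ne' ht
    · rintro _ ⟨t, rfl⟩ _ ⟨s, rfl⟩; exact hyw t s
  · simp only [List.mem_cons, List.mem_append, List.mem_ofFn']
    intro j hj
    have hMj : M ≤ j := by
      rcases hj with rfl | ⟨t, rfl⟩ | ⟨t, rfl⟩
      · rfl
      · exact (hyM t).le
      · exact (hwM t).le
    exact ⟨by omega, avoids_of_mem_adjoin_Iio hM hMj⟩
  · intro hident
    -- Any values of `z`, `y`, `w` and `x_i` are realized by a substitution that agrees with `v` on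
    -- the other indeterminates of `g`; so if `h` were an identity, `g` would vanish on the Capelli
    -- values of degree `m`.
    refine hnv fun v Y W z x => ?_
    let u : ℕ → A := Function.extend y Y (Function.extend w W (Function.update v M z))
    have huy : (fun j => u (y j)) = Y := funext fun j => hy.extend_apply _ _ _
    have huw : (fun j => u (w j)) = W := by
      funext j
      simp only [u]
      rw [Function.extend_apply' _ _ _ fun ⟨t, ht⟩ => hyw t j ht, hw.extend_apply]
    have hu : ∀ j ≤ M, u j = Function.update v M z j := by
      intro j hj
      simp only [u]
      rw [Function.extend_apply' _ _ _ fun ⟨t, ht⟩ => by have := hyM t; omega,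
        Function.extend_apply' _ _ _ fun ⟨t, ht⟩ => by have := hwM t; omega]
    have h := hident (Function.update u i x)
    rw [eval_update_subst hav, eval_mul, eval_X, eval_capelliPoly, huy, huw, hu M le_rfl,
      Function.update_self] at h
    rw [← h]
    refine hcongr _ _ _ fun j hj => ?_
    rw [hu j hj.le, Function.update_of_ne hj.ne]
  · intro Φ hΦ r s k l a b
    -- The value of `h` as a function of the Capelli value alone; it is additive because `g` is
    -- quasi-linear.
    let T : (ℕ → A) → A →+ A := fun v => AddMonoidHom.mk'
      (fun x => eval (Function.update v i (v M * x * v i)) g) fun x x' => by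
        rw [mul_add, add_mul, hg.quasi]
    refine alphaPol_comm_of_mem_coeffModule (w := w) hy T (fun v c hc => hkill c hc v _ _)
      (fun v Y => ?_) hΦ (p ^ r) (p ^ s) k l a b
    have hext : ∀ j ≤ M, Function.extend y Y v j = v j := fun j hj =>
      Function.extend_apply' _ _ _ fun ⟨t, ht⟩ => by have := hyM t; omega
    have h1 := eval_update_subst hav g (Function.extend y Y v) (v i)
    rw [← hext i hiM.le, Function.update_eq_self] at h1
    refine h1.trans ?_
    rw [eval_mul, eval_X, congrFun (eval_extend_capelliPoly hy hyw v) Y, hext M le_rfl,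
      hext i hiM.le]
    exact hcongr _ _ _ fun j hj => hext j hj.le
  · intro h' hh v
    obtain ⟨b, c, hc, hx⟩ := hh.exists_eval v
    have h1 := hx (v i)
    -- In `z c_{m²} (b * c * x)`, the factor to the left of `c` is regrouped as `z c_{m²} b`, so `g`
    -- vanishes there by `hkill`.
    rw [Function.update_eq_self, eval_update_subst hav, ← mul_assoc, ← mul_assoc] at h1
    rw [h1]
    exact hkill c hc v _ _
  · intro r k hk a v
    exact alphaPol_capelliPoly p hy hyw hk a v
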